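/- An \emph{oriented surface} is a smooth, second countable, Hausdorff, oriented $2$-manifold without boundary (not necessarily connected, compact or nonempty). For an oriented surface $\Sigma$ let $\mathbb{K}(\Sigma)$ be the set of smooth embeddings $\mathbb{S}^1\to\Sigma\times\mathbb{R}$ with the $C^\infty$ topology, i.e. the topology induced from the compact-open topology by the $\infty$-jet map. An orientation preserving smooth embedding $\psi:\Sigma_1\to\Sigma_2$ induces a map $\Psi:\mathbb{K}(\Sigma_1)\to\mathbb{K}(\Sigma_2)$, $\Psi(K)=(\psi\times\mathrm{id})\circ K$. Let $\mathbf{VK}$ be the category whose objects are the open sets $U\subseteq\mathbb{K}(\Sigma)$, for all oriented surfaces $\Sigma$, and whose arrows from $U_1\subseteq\mathbb{K}(\Sigma_1)$ to $U_2\subseteq\mathbb{K}(\Sigma_2)$ are the functions $U_1\to U_2$ that are restrictions of maps $\Psi$ as above with $\Psi(U_1)\subseteq U_2$. A sieve on $U$ is covering if $U$ is the union of the images of its arrows; this is a Grothendieck topology on $\mathbf{VK}$, and $\mathrm{Sh}(\mathbf{VK})$ denotes the topos of sheaves of sets on this site. For a set $\mathbb{G}$ with the discrete topology, $\mathrm{Sh}(\mathbf{G})$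 denotes the topos of sheaves of sets on $\mathbb{G}$. A geometric morphism $f:\mathscr{E}\to\mathscr{F}$ is an adjunction $f^*\dashv f_*$ with $f^*:\mathscr{F}\to\mathscr{E}$ preserving finite limits; two geometric morphisms $f,g$ are isomorphic if $f^*$ and $g^*$ are naturally isomorphic. Let $F:\mathbf{VK}\to\mathbf{Sets}$ be the forgetful functor. A \emph{variable-space knot} is a connected component of the category of elements $\int_{\mathbf{VK}}F$; write $\pi_0(\int_{\mathbf{VK}}F)$ for the set of variable-space knots and $\mathbf{V}_{(U,K)}$ for the one that contains $(U,K)$, where $K\in U$. A \emph{variable-space isotopy} from $\mathbf{V}_0$ to $\mathbf{V}_1$ is a function $\sigma:[0,1]\to\pi_0(\int_{\mathbf{VK}}F)$ with $\sigma(0)=\mathbf{V}_0$ and $\sigma(1)=\mathbf{V}_1$ such that for every object $U$ of $\mathbf{VK}$, every $t\in[0,1]$ and every $K\in U$ with $\mathbf{V}_{(U,K)}=\sigma(t)$ there are a neighborhood $N$ of $t$ in $[0,1]$ and a continuous function $\gamma:N\to U$ with $\gamma(t)=K$ and $\mathbf{V}_{(U,\gamma(s))}=\sigma(s)$ for all $s\in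 N$. A \emph{variable-space knot invariant valued in $\mathbb{G}$} is a function $\nu:\pi_0(\int_{\mathbf{VK}}F)\to\mathbb{G}$ such that $\nu(\sigma(0))=\nu(\sigma(1))$ for every variable-space isotopy $\sigma$. \textbf{Theorem.} For every set $\mathbb{G}$ with the discrete topology there is a bijection $[f]\mapsto\nu_f$ from the isomorphism classes of geometric morphisms $f:\mathrm{Sh}(\mathbf{VK})\to\mathrm{Sh}(\mathbf{G})$ to the variable-space knot invariants valued in $\mathbb{G}$, such that for all $f$, all objects $U$ of $\mathbf{VK}$ and all $H\subseteq\mathbb{G}$, \[ f^*(\mathbf{y}H)(U)\neq\varnothing\iff \nu_f(\mathbf{V}_{(U,K)})\in H\ \text{ for all } K\in U, \] where $\mathbf{y}H$ is the sheaf on $\mathbb{G}$ represented by the open set $H$. -/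

import Mathlib

open CategoryTheory TopologicalSpace Topology Set
open scoped Manifold ContDiff

universe w

namespace VirtualKnot

/-- An oriented smooth surface: a Hausdorff second countable `2`-manifold without boundary, with a
smooth atlas whose transition maps have positive Jacobian determinant. -/
structure OrientedSurface : Type 1 where
  carrier : Type
  [topologicalSpace : TopologicalSpace carrier]
  [t2Space : T2Space carrier]
  [secondCountable : SecondCountableTopology carrier]
  [chartedSpace : ChartedSpace (EuclideanSpace ℝ (Fin 2)) carrier]
  [isManifold : IsManifold (𝓡 2) ∞ carrier]
  oriented : ∀ e ∈ atlas (EuclideanSpace ℝ (Fin 2)) carrier,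
    ∀ e' ∈ atlas (EuclideanSpace ℝ (Fin 2)) carrier,
    ∀ x ∈ (e.symm.trans e').source, 0 < (fderiv ℝ (e.symm.trans e') x).det

attribute [instance] OrientedSurface.topologicalSpace OrientedSurface.t2Space
  OrientedSurface.secondCountable OrientedSurface.chartedSpace OrientedSurface.isManifold

instance : CoeSort OrientedSurface Type := ⟨OrientedSurface.carrier⟩

/-- The Jacobian determinant of a map of oriented surfaces at `x`, in the preferred charts (of the
oriented atlases) at `x` and at `ψ x`. -/
noncomputable def jacobian {S T : OrientedSurface} (ψ : S → T) (x : S) : ℝ :=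
  (fderiv ℝ (chartAt (EuclideanSpace ℝ (Fin 2)) (ψ x) ∘ ψ ∘
    (chartAt (EuclideanSpace ℝ (Fin 2)) x).symm) (chartAt (EuclideanSpace ℝ (Fin 2)) x x)).det

/-- Orientation preserving smooth embeddings of oriented surfaces: smooth maps that are
homeomorphisms onto their image and whose differential is everywhere invertible, with positive
determinant. -/
structure IsOrientedEmbedding {S T : OrientedSurface} (ψ : S → T) : Prop where
  contMDiff : ContMDiff (𝓡 2) (𝓡 2) ∞ ψ
  isEmbedding : IsEmbedding ψ
  jacobian_pos : ∀ x, 0 < jacobian ψ x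

theorem contDiffAt_chart {S T : OrientedSurface} {ψ : S → T} {x : S}
    (h : ContMDiffAt (𝓡 2) (𝓡 2) ∞ ψ x) :
    ContDiffAt ℝ ∞ (chartAt (EuclideanSpace ℝ (Fin 2)) (ψ x) ∘ ψ ∘
      (chartAt (EuclideanSpace ℝ (Fin 2)) x).symm) (chartAt (EuclideanSpace ℝ (Fin 2)) x x) := by
  have h1 := (contMDiffAt_iff.1 h).2
  simpa only [mfld_simps, contDiffWithinAt_univ] using h1

theorem jacobian_comp {S T R : OrientedSurface} {φ : T → R} {ψ : S → T} (x : S)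
    (hφ : ContMDiff (𝓡 2) (𝓡 2) ∞ φ) (hψ : ContMDiff (𝓡 2) (𝓡 2) ∞ ψ) :
    jacobian (φ ∘ ψ) x = jacobian φ (ψ x) * jacobian ψ x := by
  have h1 := (contDiffAt_chart (hψ x)).differentiableAt (by simp)
  have h2 := (contDiffAt_chart (hφ (ψ x))).differentiableAt (by simp)
  set c := chartAt (EuclideanSpace ℝ (Fin 2)) x
  set d := chartAt (EuclideanSpace ℝ (Fin 2)) (ψ x)
  set e := chartAt (EuclideanSpace ℝ (Fin 2)) (φ (ψ x))
  have hc : x ∈ c.source := mem_chart_source _ x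
  have hd : ψ x ∈ d.source := mem_chart_source _ (ψ x)
  have hx : (d ∘ ψ ∘ c.symm) (c x) = d (ψ x) := by simp [c.left_inv hc]
  have h3 : (e ∘ (φ ∘ ψ) ∘ c.symm) =ᶠ[𝓝 (c x)] (e ∘ φ ∘ d.symm) ∘ (d ∘ ψ ∘ c.symm) := by
    have : ContinuousAt (ψ ∘ c.symm) (c x) :=
      hψ.continuous.continuousAt.comp (c.continuousAt_symm (c.map_source hc))
    filter_upwards [this.preimage_mem_nhds (d.open_source.mem_nhds
      (by simpa [c.left_inv hc] using hd))] with y hy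
    simp [d.left_inv (show ψ (c.symm y) ∈ d.source from hy)]
  change (fderiv ℝ (e ∘ (φ ∘ ψ) ∘ c.symm) (c x)).det =
    (fderiv ℝ (e ∘ φ ∘ d.symm) (d (ψ x))).det * (fderiv ℝ (d ∘ ψ ∘ c.symm) (c x)).det
  rw [h3.fderiv_eq, fderiv_comp _ (by rw [hx]; exact h2) h1, hx]
  exact LinearMap.det_comp _ _

theorem jacobian_id {S : OrientedSurface} (x : S) : jacobian (fun x : S ↦ x) x = 1 := by
  set c := chartAt (EuclideanSpace ℝ (Fin 2)) x
  have hc : x ∈ c.source := mem_chart_source _ x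
  have h : c ∘ (fun x : S ↦ x) ∘ c.symm =ᶠ[𝓝 (c x)] id := by
    filter_upwards [c.open_target.mem_nhds (c.map_source hc)] with y hy
    simp [c.right_inv hy]
  rw [jacobian, h.fderiv_eq, fderiv_id]
  simp [ContinuousLinearMap.det]

theorem IsOrientedEmbedding.id (S : OrientedSurface) :
    IsOrientedEmbedding (fun x : S ↦ x) where
  contMDiff := contMDiff_id
  isEmbedding := .id
  jacobian_pos x := by simp [jacobian_id]

theorem IsOrientedEmbedding.comp {S T R : OrientedSurface} {φ : T → R} {ψ : S → T}
    (hφ : IsOrientedEmbedding φ) (hψ : IsOrientedEmbedding ψ) : IsOrientedEmbedding (φ ∘ ψ) where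
  contMDiff := hφ.contMDiff.comp hψ.contMDiff
  isEmbedding := hφ.isEmbedding.comp hψ.isEmbedding
  jacobian_pos x := by
    rw [jacobian_comp x hφ.contMDiff hψ.contMDiff]
    exact mul_pos (hφ.jacobian_pos _) (hψ.jacobian_pos _)

theorem IsOrientedEmbedding.chart_hasFDerivAt {S T : OrientedSurface} {ψ : S → T}
    (hψ : IsOrientedEmbedding ψ) (x : S) :
    ∃ A : EuclideanSpace ℝ (Fin 2) ≃L[ℝ] EuclideanSpace ℝ (Fin 2),
      HasFDerivAt (chartAt (EuclideanSpace ℝ (Fin 2)) (ψ x) ∘ ψ ∘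
        (chartAt (EuclideanSpace ℝ (Fin 2)) x).symm)
        (A : EuclideanSpace ℝ (Fin 2) →L[ℝ] EuclideanSpace ℝ (Fin 2))
        (chartAt (EuclideanSpace ℝ (Fin 2)) x x) := by
  have h := (hψ.jacobian_pos x).ne'
  rw [jacobian] at h
  refine ⟨ContinuousLinearMap.toContinuousLinearEquivOfDetNeZero _ h, ?_⟩
  rw [ContinuousLinearMap.coe_toContinuousLinearEquivOfDetNeZero]
  exact ((contDiffAt_chart (hψ.contMDiff x)).differentiableAt (by simp)).hasFDerivAt

theorem IsOrientedEmbedding.mfderiv_injective {S T : OrientedSurface} {ψ : S → T}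
    (hψ : IsOrientedEmbedding ψ) (x : S) : Function.Injective (mfderiv (𝓡 2) (𝓡 2) ψ x) := by
  obtain ⟨A, hA⟩ := hψ.chart_hasFDerivAt x
  have h : HasMFDerivAt (𝓡 2) (𝓡 2) ψ x
      (A : EuclideanSpace ℝ (Fin 2) →L[ℝ] EuclideanSpace ℝ (Fin 2)) := by
    refine ⟨hψ.contMDiff.continuous.continuousAt, ?_⟩
    simp only [writtenInExtChartAt, mfld_simps]
    exact hA.hasFDerivWithinAt
  rw [h.mfderiv]
  exact A.injective

theorem IsOrientedEmbedding.isOpenEmbedding {S T : OrientedSurface} {ψ : S → T}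
    (hψ : IsOrientedEmbedding ψ) : IsOpenEmbedding ψ := by
  refine .of_isEmbedding_isOpenMap hψ.isEmbedding (isOpenMap_iff_nhds_le.2 fun x ↦ ?_)
  obtain ⟨A, hA⟩ := hψ.chart_hasFDerivAt x
  have h1 := contDiffAt_chart (hψ.contMDiff x)
  have h2 := (h1.hasStrictFDerivAt' hA (by simp)).map_nhds_eq_of_equiv
  set c := chartAt (EuclideanSpace ℝ (Fin 2)) x
  set d := chartAt (EuclideanSpace ℝ (Fin 2)) (ψ x)
  have hc : x ∈ c.source := mem_chart_source _ x
  have hd : ψ x ∈ d.source := mem_chart_source _ (ψ x)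
  have h3 : ψ =ᶠ[𝓝 x] d.symm ∘ (d ∘ ψ ∘ c.symm) ∘ c := by
    filter_upwards [c.open_source.mem_nhds hc,
      hψ.contMDiff.continuous.continuousAt.preimage_mem_nhds (d.open_source.mem_nhds hd)]
      with y hy hy'
    simp [c.left_inv hy, d.left_inv (show ψ y ∈ d.source from hy')]
  rw [Filter.map_congr h3, ← Filter.map_map, ← Filter.map_map, c.map_nhds_eq hc, h2]
  simp only [Function.comp_apply, c.left_inv hc]
  rw [d.symm.map_nhds_eq (d.map_source hd), d.left_inv hd]

theorem IsOrientedEmbedding.contMDiffAt_symm {S T : OrientedSurface} {ψ : S → T}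
    (hψ : IsOrientedEmbedding ψ) (Φ : OpenPartialHomeomorph S T) (hΦ : ⇑Φ = ψ)
    (x : S) (hx : x ∈ Φ.source) : ContMDiffAt (𝓡 2) (𝓡 2) ∞ Φ.symm (ψ x) := by
  have hinv : Φ.symm (ψ x) = x := by rw [← hΦ]; exact Φ.left_inv hx
  have hxt : ψ x ∈ Φ.target := by rw [← hΦ]; exact Φ.map_source hx
  refine contMDiffAt_iff.2 ⟨Φ.continuousAt_symm hxt, ?_⟩
  obtain ⟨A, hA⟩ := hψ.chart_hasFDerivAt x
  have h1 := contDiffAt_chart (hψ.contMDiff x)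
  rw [hinv]
  simp only [mfld_simps, contDiffWithinAt_univ]
  set c := chartAt (EuclideanSpace ℝ (Fin 2)) x
  set d := chartAt (EuclideanSpace ℝ (Fin 2)) (ψ x)
  have hc : x ∈ c.source := mem_chart_source _ x
  have hd : ψ x ∈ d.source := mem_chart_source _ (ψ x)
  subst hΦ
  have hs : (c.symm.trans (Φ.trans d)).symm (d (Φ x)) = c x := by
    simp [hd, hinv]
  refine (c.symm.trans (Φ.trans d)).contDiffAt_symm (f₀' := A) (a := d (Φ x)) ?_ ?_ ?_
  · simp [hd, hinv, hxt, hc]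
  · rw [hs]; exact hA
  · rw [hs]; exact h1

theorem IsOrientedEmbedding.of_comp_eq {A B C : OrientedSurface} {υ : B → C}
    (hυ : IsOrientedEmbedding υ) {φ : A → C} (hφ : IsOrientedEmbedding φ) {θ : A → B}
    (h : υ ∘ θ = φ) : IsOrientedEmbedding θ := by
  have hc : Continuous θ := hυ.isEmbedding.continuous_iff.2 (h ▸ hφ.contMDiff.continuous)
  have hs : ContMDiff (𝓡 2) (𝓡 2) ∞ θ := by
    intro a
    have : Nonempty B := ⟨θ a⟩
    let Φ := hυ.isOpenEmbedding.toOpenPartialHomeomorph υ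
    have h1 : θ = Φ.symm ∘ φ := by
      funext y
      have := Φ.left_inv (x := θ y) (by simp [Φ])
      rw [← h]
      exact this.symm
    have h2 := hυ.contMDiffAt_symm Φ rfl (θ a) (by simp [Φ])
    rw [h1]
    refine ContMDiffAt.comp a ?_ (hφ.contMDiff a)
    rw [← h]
    exact h2
  refine ⟨hs, .of_comp hc hυ.contMDiff.continuous (h ▸ hφ.isEmbedding), fun x ↦ ?_⟩
  have h1 := hφ.jacobian_pos x
  rw [← h, jacobian_comp x hυ.contMDiff hs] at h1
  exact pos_of_mul_pos_right h1 (hυ.jacobian_pos _).le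

/-- An open subset of an oriented surface is an oriented surface. -/
noncomputable def OrientedSurface.restrict (S : OrientedSurface) (O : Opens S) : OrientedSurface where
  carrier := O
  oriented := by
    intro e he e' he' x hx
    obtain ⟨p, hp⟩ := mem_iUnion.1 he
    obtain ⟨q, hq⟩ := mem_iUnion.1 he'
    rw [mem_singleton_iff] at hp hq
    subst hp hq
    set c := chartAt (EuclideanSpace ℝ (Fin 2)) p.1
    set d := chartAt (EuclideanSpace ℝ (Fin 2)) q.1
    have h := OpenPartialHomeomorph.subtypeRestr_symm_trans_subtypeRestr ⟨p⟩ c d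
    have hx' := hx
    rw [h.1, OpenPartialHomeomorph.restr_source] at hx'
    have hn : ((c.subtypeRestr ⟨p⟩).symm.trans (d.subtypeRestr ⟨p⟩)).source ∈ 𝓝 x :=
      (OpenPartialHomeomorph.open_source _).mem_nhds hx
    rw [(Set.EqOn.eventuallyEq_of_mem h.2 hn).fderiv_eq]
    exact S.oriented _ (chart_mem_atlas _ _) _ (chart_mem_atlas _ _) x hx'.1

/-- The inclusion of an open subset. -/
def OrientedSurface.incl (S : OrientedSurface) (O : Opens S) : S.restrict O → S :=
  fun x ↦ Subtype.val (p := (· ∈ O)) x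

theorem OrientedSurface.isOrientedEmbedding_incl (S : OrientedSurface) (O : Opens S) :
    IsOrientedEmbedding (S.incl O) where
  contMDiff := contMDiff_subtype_val
  isEmbedding := .subtypeVal
  jacobian_pos x := by
    set c := chartAt (EuclideanSpace ℝ (Fin 2)) x
    have hc : x ∈ c.source := mem_chart_source _ x
    have h : (chartAt (EuclideanSpace ℝ (Fin 2)) (S.incl O x)) ∘ S.incl O ∘ c.symm
        =ᶠ[𝓝 (c x)] id := by
      filter_upwards [c.open_target.mem_nhds (c.map_source hc)] with y hy
      exact c.right_inv hy
    rw [jacobian, h.fderiv_eq, fderiv_id]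
    simp [ContinuousLinearMap.det]

/-- A knot in the thickened surface `S × ℝ`: a smooth embedding of the circle. -/
structure Knot (S : OrientedSurface) where
  toFun : Circle → S × ℝ
  contMDiff : ContMDiff (𝓡 1) ((𝓡 2).prod 𝓘(ℝ, ℝ)) ∞ toFun
  injective_mfderiv : ∀ z,
    Function.Injective (mfderiv (𝓡 1) ((𝓡 2).prod 𝓘(ℝ, ℝ)) toFun z)
  isEmbedding : IsEmbedding toFun

theorem Knot.ext {S : OrientedSurface} {K L : Knot S} (h : ∀ z, K.toFun z = L.toFun z) :
    K = L := by
  cases K; cases L; congr; exact funext h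

/-- The map `Ψ` on knots induced by `ψ × id`. -/
def Knot.push {S T : OrientedSurface} (ψ : S → T) (hψ : IsOrientedEmbedding ψ) (K : Knot S) :
    Knot T where
  toFun z := Prod.map ψ id (K.toFun z)
  contMDiff := (hψ.contMDiff.prodMap contMDiff_id).comp K.contMDiff
  injective_mfderiv z := by
    have hg : MDifferentiable ((𝓡 2).prod 𝓘(ℝ, ℝ)) ((𝓡 2).prod 𝓘(ℝ, ℝ))
        (Prod.map ψ (id : ℝ → ℝ)) :=
      (hψ.contMDiff.prodMap contMDiff_id).mdifferentiable (by simp)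
    have hd := hψ.contMDiff.mdifferentiable (by simp)
    intro v w hvw
    change mfderiv _ _ (Prod.map ψ (id : ℝ → ℝ) ∘ K.toFun) z v =
      mfderiv _ _ (Prod.map ψ (id : ℝ → ℝ) ∘ K.toFun) z w at hvw
    have hK := K.contMDiff.mdifferentiable (by simp) z
    rw [mfderiv_comp_apply _ (hg _) hK, mfderiv_comp_apply _ (hg _) hK,
      mfderiv_prodMap (hd _) mdifferentiableAt_id] at hvw
    refine K.injective_mfderiv z (Prod.ext ?_ ?_)
    · have h := congrArg Prod.fst hvw
      exact hψ.mfderiv_injective _ h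
    · have h := congrArg Prod.snd hvw
      rw [mfderiv_id] at h
      exact h
  isEmbedding := (hψ.isEmbedding.prodMap .id).comp K.isEmbedding

/-- A knot lying over an open subset of the surface, as a knot in the thickening of this subset. -/
noncomputable def Knot.restrict {S : OrientedSurface} (K : Knot S) (O : Opens S)
    (h : ∀ z, (K.toFun z).1 ∈ O) : Knot (S.restrict O) :=
  have hs : ContMDiff (𝓡 1) ((𝓡 2).prod 𝓘(ℝ, ℝ)) ∞
      (fun z ↦ ((⟨(K.toFun z).1, h z⟩, (K.toFun z).2) : O × ℝ)) :=
    ((ContMDiff.subtypeVal_comp_iff O _).1 (contMDiff_fst.comp K.contMDiff)).prodMk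
      (contMDiff_snd.comp K.contMDiff)
  have hp : ContMDiff ((𝓡 2).prod 𝓘(ℝ, ℝ)) ((𝓡 2).prod 𝓘(ℝ, ℝ)) ∞
      (Prod.map (Subtype.val : O → S) (id : ℝ → ℝ)) :=
    contMDiff_subtype_val.prodMap contMDiff_id
  { toFun := fun z ↦ ((⟨(K.toFun z).1, h z⟩, (K.toFun z).2) : O × ℝ)
    contMDiff := hs
    injective_mfderiv := fun z v w hvw ↦ by
      refine K.injective_mfderiv z ?_
      change mfderiv _ _ (Prod.map (Subtype.val : O → S) (id : ℝ → ℝ) ∘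
          fun z ↦ ((⟨(K.toFun z).1, h z⟩, (K.toFun z).2) : O × ℝ)) z v =
        mfderiv _ _ (Prod.map (Subtype.val : O → S) (id : ℝ → ℝ) ∘
          fun z ↦ ((⟨(K.toFun z).1, h z⟩, (K.toFun z).2) : O × ℝ)) z w
      rw [mfderiv_comp_apply _ (hp.mdifferentiable (by simp) _) (hs.mdifferentiable (by simp) _),
        mfderiv_comp_apply _ (hp.mdifferentiable (by simp) _) (hs.mdifferentiable (by simp) _)]
      exact congrArg _ hvw
    isEmbedding := .of_comp hs.continuous hp.continuous K.isEmbedding }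

/-- The `∞`-jet of a knot at `Circle.exp t`, in a chart `e` of the surface: the derivatives of all
orders at `t`. -/
noncomputable def Knot.jet {S : OrientedSurface}
    (e : OpenPartialHomeomorph S (EuclideanSpace ℝ (Fin 2))) (K : Knot S) (t : ℝ) :
    ℕ → EuclideanSpace ℝ (Fin 2) × ℝ :=
  fun k ↦ iteratedDeriv k
    (fun s ↦ (e (K.toFun (Circle.exp s)).1, (K.toFun (Circle.exp s)).2)) t

/-- The `C^∞` topology on the space of knots in `S × ℝ`: the compact-open topology on the
`∞`-jet prolongations of knots. A subbasic open set consists of the knots whose jets over a compact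
set `C` of parameters lie in a given open set `W` of jets, in a chart `e` of the smooth structure;
the space of `∞`-jets (a sequence of derivatives) has the product topology. -/
instance (S : OrientedSurface) : TopologicalSpace (Knot S) :=
  generateFrom {A | ∃ e ∈ IsManifold.maximalAtlas (𝓡 2) ∞ S, ∃ C : Set ℝ, IsCompact C ∧
    ∃ W : Set (ℕ → EuclideanSpace ℝ (Fin 2) × ℝ), IsOpen W ∧
      A = {K : Knot S | ∀ t ∈ C, (K.toFun (Circle.exp t)).1 ∈ e.source ∧ K.jet e t ∈ W}}

theorem Knot.continuous_push {S T : OrientedSurface} {ψ : S → T} (hψ : IsOrientedEmbedding ψ) :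
    Continuous (Knot.push ψ hψ) := by
  refine continuous_generateFrom_iff.2 ?_
  rintro _ ⟨e, he, C, hC, W, hW, rfl⟩
  rcases isEmpty_or_nonempty S with hS | hS
  · have : IsEmpty (Knot S) := ⟨fun K ↦ hS.false (K.toFun 1).1⟩
    rw [Set.eq_empty_of_isEmpty (Knot.push ψ hψ ⁻¹' _)]
    exact isOpen_empty
  let Φ := hψ.isOpenEmbedding.toOpenPartialHomeomorph ψ
  refine isOpen_generateFrom_of_mem ⟨Φ.trans e, ?_, C, hC, W, hW, ?_⟩
  · refine OpenPartialHomeomorph.mem_maximalAtlas_of_contMDiffOn _ ?_ ?_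
    · refine (contMDiffOn_of_mem_maximalAtlas he).comp hψ.contMDiff.contMDiffOn ?_
      intro x hx
      simpa [Φ] using hx
    · intro y hy
      rw [OpenPartialHomeomorph.trans_target] at hy
      have h1 := contMDiffAt_symm_of_mem_maximalAtlas he hy.1
      obtain ⟨x, hx⟩ : ∃ x, ψ x = e.symm y := by simpa [Φ] using hy.2
      have h2 := hψ.contMDiffAt_symm Φ rfl x (by simp [Φ])
      rw [hx] at h2
      exact (h2.comp y h1).contMDiffWithinAt
  · ext K
    simp [Knot.push, Φ]
    rfl

/-- Objects of the virtual knot site: an oriented surface `S` and an open set of knots in `S × ℝ`. -/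
structure VK : Type 1 where
  surface : OrientedSurface
  nbhd : Opens (Knot surface)

/-- An arrow of the virtual knot site: a function of sets of knots that is the restriction of the
map `Ψ` induced by some orientation preserving smooth embedding `ψ` of surfaces. -/
@[ext]
structure VK.Hom (U V : VK) where
  toFun : U.nbhd → V.nbhd
  exists_embedding : ∃ (ψ : U.surface → V.surface) (hψ : IsOrientedEmbedding ψ),
    ∀ K : U.nbhd, (toFun K : Knot V.surface) = Knot.push ψ hψ K

instance : Category.{0} VK where
  Hom := VK.Hom
  id U := ⟨fun K ↦ K, _, .id _, fun _ ↦ rfl⟩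
  comp {U V W} f g := ⟨fun K ↦ g.toFun (f.toFun K), by
    obtain ⟨φ, hφ, hf⟩ := f.exists_embedding
    obtain ⟨ψ, hψ, hg⟩ := g.exists_embedding
    exact ⟨ψ ∘ φ, hψ.comp hφ, fun K ↦ by rw [hg, hf]; rfl⟩⟩

/-- The topology on the virtual knot site: a sieve on `U` is covering if `U` is the union of the
images of its arrows. -/
def topologyVK : GrothendieckTopology VK where
  sieves U := {R | ∀ K : U.nbhd, ∃ (V : VK) (f : V ⟶ U) (L : V.nbhd), R f ∧ f.toFun L = K}
  top_mem' U K := ⟨U, 𝟙 U, K, trivial, rfl⟩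
  pullback_stable' := by
    intro U V R g hR K
    obtain ⟨W, f, L, hRf, hL⟩ := hR (g.toFun K)
    obtain ⟨φ, hφ, hg⟩ := g.exists_embedding
    obtain ⟨υ, hυ, hf⟩ := f.exists_embedding
    have hKL : ∀ z, υ (L.1.toFun z).1 = φ (K.1.toFun z).1 := fun z ↦ by
      have h1 : Knot.push υ hυ L.1 = Knot.push φ hφ K.1 := by rw [← hf, ← hg, hL]
      exact congrArg (fun J : Knot U.surface ↦ (J.toFun z).1) h1
    have hKL' : ∀ z, (L.1.toFun z).2 = (K.1.toFun z).2 := fun z ↦ by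
      have h1 : Knot.push υ hυ L.1 = Knot.push φ hφ K.1 := by rw [← hf, ← hg, hL]
      exact congrArg (fun J : Knot U.surface ↦ (J.toFun z).2) h1
    let O : Opens V.surface :=
      ⟨φ ⁻¹' range υ, hυ.isOpenEmbedding.isOpen_range.preimage hφ.contMDiff.continuous⟩
    let i := V.surface.incl O
    have hi : IsOrientedEmbedding i := V.surface.isOrientedEmbedding_incl O
    have hO : ∀ x : V.surface.restrict O, ∃ y, υ y = φ (i x) := fun x ↦ x.2
    choose θ hθ using hO
    have hθe : IsOrientedEmbedding θ := hυ.of_comp_eq (hφ.comp hi) (funext hθ)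
    let X : VK := ⟨V.surface.restrict O,
      ⟨Knot.push i hi ⁻¹' V.nbhd ∩ Knot.push θ hθe ⁻¹' W.nbhd,
        (V.nbhd.2.preimage (Knot.continuous_push hi)).inter
          (W.nbhd.2.preimage (Knot.continuous_push hθe))⟩⟩
    let a : X ⟶ V := VK.Hom.mk (fun J ↦ ⟨Knot.push i hi J.1, J.2.1⟩) ⟨i, hi, fun _ ↦ rfl⟩
    let b : X ⟶ W := VK.Hom.mk (fun J ↦ ⟨Knot.push θ hθe J.1, J.2.2⟩) ⟨θ, hθe, fun _ ↦ rfl⟩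
    have hab : a ≫ g = b ≫ f := by
      refine VK.Hom.ext (funext fun J ↦ Subtype.ext ?_)
      change (g.toFun (a.toFun J) : Knot U.surface) = (f.toFun (b.toFun J) : Knot U.surface)
      rw [hg, hf]
      refine Knot.ext fun z ↦ Prod.ext ?_ rfl
      exact (hθ _).symm
    let K' : Knot (V.surface.restrict O) :=
      K.1.restrict O fun z ↦ ⟨(L.1.toFun z).1, hKL z⟩
    have h1 : Knot.push i hi K' = K.1 := Knot.ext fun z ↦ rfl
    have h2 : Knot.push θ hθe K' = L.1 := Knot.ext fun z ↦
      Prod.ext (hυ.isEmbedding.injective ((hθ _).trans (hKL z).symm)) (hKL' z).symm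
    refine ⟨X, a, ⟨K', ?_, ?_⟩, ?_, Subtype.ext h1⟩
    · change Knot.push i hi K' ∈ V.nbhd
      rw [h1]; exact K.2
    · change Knot.push θ hθe K' ∈ W.nbhd
      rw [h2]; exact L.2
    · change R (a ≫ g)
      rw [hab]
      exact R.downward_closed hRf b
  transitive' := by
    intro U R hR R' hR' K
    obtain ⟨V, f, L, hf, rfl⟩ := hR K
    obtain ⟨W, g, J, hg, rfl⟩ := hR' hf L
    exact ⟨W, g ≫ f, J, hg, rfl⟩

/-- The forgetful functor, sending a neighbourhood to its set of knots. -/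
def forgetVK : VK ⥤ Type where
  obj U := U.nbhd
  map f := ↾ f.toFun

/-- A variable-space knot is a connected component of the category of elements of the forgetful
functor. -/
abbrev VariableSpaceKnot : Type 1 := ConnectedComponents forgetVK.Elements

/-- The variable-space knot that contains the object `(U, K)`. -/
def variableSpaceKnot (U : VK) (K : U.nbhd) : VariableSpaceKnot :=
  Quotient.mk _ (forgetVK.elementsMk U K)

/-- A variable-space isotopy from `V₀` to `V₁`: a path of variable-space knots which, in every
object `U`, lifts locally (through any given representative in `U`) to a continuous path of knots
in `U`. -/
structure VariableSpaceIsotopy (V₀ V₁ : VariableSpaceKnot) where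
  toFun : unitInterval → VariableSpaceKnot
  locally_continuous : ∀ (U : VK) (t : unitInterval) (K : U.nbhd),
    variableSpaceKnot U K = toFun t →
      ∃ (N : Set unitInterval) (hN : N ∈ 𝓝 t) (γ : N → U.nbhd), Continuous γ ∧
        γ ⟨t, mem_of_mem_nhds hN⟩ = K ∧ ∀ s : N, variableSpaceKnot U (γ s) = toFun s
  map_zero : toFun 0 = V₀
  map_one : toFun 1 = V₁

/-- A variable-space knot invariant valued in `G`. -/
structure VariableSpaceKnotInvariant (G : Type*) where
  toFun : VariableSpaceKnot → G
  invariant : ∀ {V₀ V₁ : VariableSpaceKnot}, VariableSpaceIsotopy V₀ V₁ → toFun V₀ = toFun V₁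

section Topos

universe u₁ v₁ u₂ v₂

/-- A geometric morphism `E → F`: an adjunction between an inverse image functor `F ⥤ E` that
preserves finite limits and a direct image functor `E ⥤ F`. -/
structure GeometricMorphism (E : Type u₁) [Category.{v₁} E] (F : Type u₂) [Category.{v₂} F] where
  inverseImage : F ⥤ E
  directImage : E ⥤ F
  adjunction : inverseImage ⊣ directImage
  preservesFiniteLimits : Limits.PreservesFiniteLimits inverseImage

/-- The category of geometric morphisms; an arrow is a natural transformation of inverse image
functors. -/
instance (E : Type u₁) [Category.{v₁} E] (F : Type u₂) [Category.{v₂} F] :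
    Category (GeometricMorphism E F) where
  Hom f g := f.inverseImage ⟶ g.inverseImage
  id f := 𝟙 f.inverseImage
  comp a b := NatTrans.vcomp a b

/-- Geometric morphisms up to isomorphism. -/
abbrev GeometricMorphismClass (E : Type u₁) [Category.{v₁} E] (F : Type u₂) [Category.{v₂} F] :=
  Quotient (isIsomorphicSetoid (GeometricMorphism E F))

/-- The virtual knot space: the topos of sheaves of sets on the virtual knot site. The sets lie in a
universe in which the virtual knot site is a small category. -/
abbrev ShVK := Sheaf topologyVK (Type (max 1 w))

/-- The topos of sheaves of sets on a topological space, in the same universe of sets. -/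
abbrev Sh (G : Type w) [TopologicalSpace G] :=
  Sheaf (Opens.grothendieckTopology G) (Type (max 1 w))

instance (G : Type w) [TopologicalSpace G] : (Opens.grothendieckTopology G).Subcanonical := by
  refine .of_isSheaf_yoneda_obj _ fun H X S hS x _ ↦ ?_
  have h : X ≤ H := fun p hp ↦ by
    obtain ⟨Y, f, hf, hY⟩ := hS p hp
    exact (x f hf).le hY
  exact ⟨homOfLE h, fun Z _ _ ↦ Subsingleton.elim (α := Z ⟶ H) _ _,
    fun _ _ ↦ Subsingleton.elim (α := X ⟶ H) _ _⟩

/-- The representable sheaf of an open set `H`. -/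
abbrev representable {G : Type w} [TopologicalSpace G] (H : Opens G) : Sh.{w} G :=
  (GrothendieckTopology.uliftYoneda.{1} (Opens.grothendieckTopology G)).obj H

end Topos

end VirtualKnot

/-!
Fix a discrete space `G`. Both sides of the bijection are identified with the functions
`ν : VariableSpaceKnot → G` for which `K ↦ ν [U, K]` is locally constant on every object `U` of the
virtual knot site (`IsLocallyConstantOnVK`).

*Geometric morphisms.* A subterminal sheaf on the site is the same thing as its support, the set of
variable-space knots represented in an object over which it has a section: arrows of the site are
open embeddings, and fibre products transport sections along zigzags (`supp_iff`,
`nonempty_iff_forall_supp`). For a geometric morphism `f`, the inverse images of the sheaves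
represented by the points of `G` are subterminal. They have disjoint supports, because the inverse
image preserves finite limits, and these supports cover everything, because morphisms into a
subterminal sheaf form, through the adjunction, a sheaf on `G`
(`GeometricMorphism.supp_of_cover`). Hence every variable-space knot lies in the support belonging
to exactly one point of `G`, which is the value of `f` (`GeometricMorphism.value`). The values
determine the inverse images of representable sheaves, hence the direct image, hence `f` up to
isomorphism (`isIsomorphic_of_nonempty_iff`). Conversely, if `ν` is locally constant, the functor
that sends `U` to the set of values of `ν` on `U` lifts covers, and so induces a geometric morphism,
whose value is `ν` (`IsLocallyConstantOnVK.exists_geometricMorphism`).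

*Isotopies.* A locally constant `ν` is constant along variable-space isotopies because `[0, 1]` is
connected. For the converse, a path of knots in an object is a variable-space isotopy
(`isotopyOfPath`): it lifts locally along zigzags, again because arrows are open embeddings. So it
is enough that every knot `K` in `S × ℝ` has a neighbourhood of knots joined to `K` by a path of
knots (`Knot.eventually_joined`). No tubular neighbourhood is needed for this. The circle is covered
by finitely many arcs which `K` maps into charts with convex target. In the chart of one arc, a loop
close to `K` is pushed along segments towards the given nearby knot `J`, with a cut-off function
that equals `1` on a smaller arc. Points where the loop already agrees with `J` stay fixed, so that after
finitely many such steps the loop is `J`. All loops that occur are `C¹`-close to `K`, and therefore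
knots (`C1Tendsto.eventually_knot`). Here `C¹`-closeness is formulated as convergence of the loops
and their derivatives along the product of a filter on the family of loops with the neighbourhood
filters of the circle.
-/

namespace VirtualKnot

open Filter Opposite

local notation "ℝ²" => EuclideanSpace ℝ (Fin 2)

/-! ### Loops in charts -/

/-- A loop `L` in `S × ℝ`, as a function of the angle, read in a chart `e` of `S`. -/
noncomputable def localRep {S : OrientedSurface} (e : OpenPartialHomeomorph S ℝ²)
    (L : Circle → S × ℝ) (t : ℝ) : ℝ² × ℝ :=
  (e (L (Circle.exp t)).1, (L (Circle.exp t)).2)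

theorem contMDiffOn_chart_prod {S : OrientedSurface} {e : OpenPartialHomeomorph S ℝ²}
    (he : e ∈ IsManifold.maximalAtlas (𝓡 2) ∞ S) :
    ContMDiffOn ((𝓡 2).prod 𝓘(ℝ, ℝ)) 𝓘(ℝ, ℝ² × ℝ) ∞ (fun p : S × ℝ ↦ (e p.1, p.2))
      (Prod.fst ⁻¹' e.source) :=
  ((contMDiffOn_of_mem_maximalAtlas he).comp contMDiff_fst.contMDiffOn subset_rfl).prodMk_space
    contMDiff_snd.contMDiffOn

theorem contMDiffOn_chart_symm_prod {S : OrientedSurface} {e : OpenPartialHomeomorph S ℝ²}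
    (he : e ∈ IsManifold.maximalAtlas (𝓡 2) ∞ S) :
    ContMDiffOn 𝓘(ℝ, ℝ² × ℝ) ((𝓡 2).prod 𝓘(ℝ, ℝ)) ∞ (fun p : ℝ² × ℝ ↦ (e.symm p.1, p.2))
      (Prod.fst ⁻¹' e.target) :=
  ((contMDiffOn_symm_of_mem_maximalAtlas he).comp contDiff_fst.contMDiff.contMDiffOn
    subset_rfl).prodMk contDiff_snd.contMDiff.contMDiffOn

theorem contDiffOn_localRep_family {S : OrientedSurface} {e : OpenPartialHomeomorph S ℝ²}
    (he : e ∈ IsManifold.maximalAtlas (𝓡 2) ∞ S) {H : ℝ × Circle → S × ℝ}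
    (hH : ContMDiff (𝓘(ℝ, ℝ).prod (𝓡 1)) ((𝓡 2).prod 𝓘(ℝ, ℝ)) ∞ H) :
    ContDiffOn ℝ ∞ (fun p : ℝ × ℝ ↦ localRep e (fun z ↦ H (p.1, z)) p.2)
      {p | (H (p.1, Circle.exp p.2)).1 ∈ e.source} := by
  have h1 : ContMDiff 𝓘(ℝ, ℝ × ℝ) (𝓘(ℝ, ℝ).prod (𝓡 1)) ∞
      (fun p : ℝ × ℝ ↦ (p.1, Circle.exp p.2)) :=
    contDiff_fst.contMDiff.prodMk (contMDiff_circleExp.comp contDiff_snd.contMDiff)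
  exact ((contMDiffOn_chart_prod he).comp (hH.comp h1).contMDiffOn
    (fun _ hp ↦ hp)).contDiffOn

theorem isOpen_localRep_family {S : OrientedSurface} (e : OpenPartialHomeomorph S ℝ²)
    {H : ℝ × Circle → S × ℝ} (hH : Continuous H) :
    IsOpen {p : ℝ × ℝ | (H (p.1, Circle.exp p.2)).1 ∈ e.source} :=
  e.open_source.preimage (continuous_fst.comp (hH.comp
    (continuous_fst.prodMk (Circle.exp.continuous.comp continuous_snd))))

theorem isOpen_localRep {S : OrientedSurface} (e : OpenPartialHomeomorph S ℝ²)
    {L : Circle → S × ℝ} (hL : Continuous L) :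
    IsOpen {t : ℝ | (L (Circle.exp t)).1 ∈ e.source} :=
  e.open_source.preimage (continuous_fst.comp (hL.comp Circle.exp.continuous))

theorem contDiffOn_localRep {S : OrientedSurface} {e : OpenPartialHomeomorph S ℝ²}
    (he : e ∈ IsManifold.maximalAtlas (𝓡 2) ∞ S) {L : Circle → S × ℝ}
    (hL : ContMDiff (𝓡 1) ((𝓡 2).prod 𝓘(ℝ, ℝ)) ∞ L) :
    ContDiffOn ℝ ∞ (localRep e L) {t | (L (Circle.exp t)).1 ∈ e.source} :=
  ((contMDiffOn_chart_prod he).comp (hL.comp contMDiff_circleExp).contMDiffOn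
    (fun _ hp ↦ hp)).contDiffOn

theorem contDiffAt_localRep {S : OrientedSurface} {e : OpenPartialHomeomorph S ℝ²}
    (he : e ∈ IsManifold.maximalAtlas (𝓡 2) ∞ S) {L : Circle → S × ℝ}
    (hL : ContMDiff (𝓡 1) ((𝓡 2).prod 𝓘(ℝ, ℝ)) ∞ L) {t : ℝ}
    (ht : (L (Circle.exp t)).1 ∈ e.source) : ContDiffAt ℝ ∞ (localRep e L) t :=
  (contDiffOn_localRep he hL).contDiffAt ((isOpen_localRep e hL.continuous).mem_nhds ht)

theorem contDiffOn_iteratedDeriv_partial {V : Type*} [NormedAddCommGroup V] [NormedSpace ℝ V]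
    {F : ℝ × ℝ → V} {Ω : Set (ℝ × ℝ)} (hΩ : IsOpen Ω) (hF : ContDiffOn ℝ ∞ F Ω) (k : ℕ) :
    ContDiffOn ℝ ∞ (fun p : ℝ × ℝ ↦ iteratedDeriv k (fun t ↦ F (p.1, t)) p.2) Ω := by
  induction k with
  | zero => simpa using hF
  | succ k ih =>
    have h1 : ContDiffOn ℝ ∞ (fun p ↦ fderiv ℝ
        (fun p : ℝ × ℝ ↦ iteratedDeriv k (fun t ↦ F (p.1, t)) p.2) p (0, 1)) Ω :=
      (ih.fderiv_of_isOpen hΩ (by simp)).clm_apply contDiffOn_const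
    refine h1.congr fun p hp ↦ ?_
    simp only [iteratedDeriv_succ]
    have h2 := ((ih.contDiffAt (hΩ.mem_nhds hp)).differentiableAt (by simp)).hasFDerivAt
    have h3 : HasDerivAt (fun t : ℝ ↦ (p.1, t)) ((0, 1) : ℝ × ℝ) p.2 :=
      (hasDerivAt_const _ _).prodMk (hasDerivAt_id _)
    exact (HasFDerivAt.comp_hasDerivAt (l := fun p : ℝ × ℝ ↦
      iteratedDeriv k (fun t ↦ F (p.1, t)) p.2) p.2 h2 h3).deriv

/-- A smooth family of knots is a continuous path in the `C^∞` topology. -/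
theorem continuous_knot_family {S : OrientedSurface} {H : ℝ × Circle → S × ℝ}
    (hH : ContMDiff (𝓘(ℝ, ℝ).prod (𝓡 1)) ((𝓡 2).prod 𝓘(ℝ, ℝ)) ∞ H)
    (γ : ℝ → Knot S) (hγ : ∀ s z, (γ s).toFun z = H (s, z)) : Continuous γ := by
  refine continuous_generateFrom_iff.2 ?_
  rintro _ ⟨e, he, C, hC, W, hW, rfl⟩
  have hγ' : ∀ s, (γ s).toFun = fun z ↦ H (s, z) := fun s ↦ funext (hγ s)
  have hΩ := isOpen_localRep_family e hH.continuous
  have hF := contDiffOn_iteratedDeriv_partial hΩ (contDiffOn_localRep_family he hH)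
  refine isOpen_iff_mem_nhds.2 fun s₀ hs₀ ↦ ?_
  refine hC.eventually_forall_of_forall_eventually
    (P := fun s t ↦ ((γ s).toFun (Circle.exp t)).1 ∈ e.source ∧ (γ s).jet e t ∈ W) ?_
  intro t ht
  obtain ⟨h1, h2⟩ := hs₀ t ht
  rw [hγ] at h1
  have hj : ∀ s t, (γ s).jet e t = fun k ↦
      iteratedDeriv k (localRep e (fun z ↦ H (s, z))) t := fun s t ↦ by
    rw [← hγ']; rfl
  have hc : ContinuousAt (fun p : ℝ × ℝ ↦ (γ p.1).jet e p.2) (s₀, t) := by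
    simp only [hj]
    exact continuousAt_pi.2 fun k ↦
      ((hF k).continuousOn.continuousAt (hΩ.mem_nhds h1))
  filter_upwards [hΩ.mem_nhds h1, hc.preimage_mem_nhds (hW.mem_nhds h2)] with p hp hp'
  exact ⟨by rw [hγ]; exact hp, hp'⟩

/-- The differential of `Circle.exp` does not vanish, since it does not after the inclusion of the
circle in `ℂ`. -/
theorem exists_hasMFDerivAt_circleExp (t : ℝ) :
    ∃ A : ℝ →L[ℝ] EuclideanSpace ℝ (Fin 1),
      HasMFDerivAt 𝓘(ℝ, ℝ) (𝓡 1) Circle.exp t A ∧ A 1 ≠ 0 := by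
  have := finrank_real_complex_fact'
  have h2 : MDifferentiable 𝓘(ℝ, ℝ) (𝓡 1) Circle.exp :=
    (contMDiff_circleExp (m := 1)).mdifferentiable (by simp)
  have h0 : ContMDiff (𝓡 1) 𝓘(ℝ, ℂ) 1 (fun z : Circle ↦ (z : ℂ)) := contMDiff_coe_sphere (E := ℂ)
  obtain ⟨A, hA⟩ : ∃ A : ℝ →L[ℝ] EuclideanSpace ℝ (Fin 1),
      HasMFDerivAt 𝓘(ℝ, ℝ) (𝓡 1) Circle.exp t A := ⟨_, (h2 t).hasMFDerivAt⟩
  obtain ⟨B, hB⟩ : ∃ B : EuclideanSpace ℝ (Fin 1) →L[ℝ] ℂ,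
      HasMFDerivAt (𝓡 1) 𝓘(ℝ, ℂ) (fun z : Circle ↦ (z : ℂ)) (Circle.exp t) B :=
    ⟨_, (h0.mdifferentiable (by simp) _).hasMFDerivAt⟩
  refine ⟨A, hA, fun h ↦ ?_⟩
  have h3 : HasFDerivAt ((fun z : Circle ↦ (z : ℂ)) ∘ Circle.exp) (B.comp A) t :=
    (hB.comp t hA).hasFDerivAt
  have h4 : ((fun z : Circle ↦ (z : ℂ)) ∘ Circle.exp) =
      fun t : ℝ ↦ Complex.exp (t * Complex.I) := by
    funext t
    exact Circle.coe_exp t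
  rw [h4] at h3
  have h5 : HasDerivAt (fun t : ℝ ↦ Complex.exp (t * Complex.I))
      (Complex.exp (t * Complex.I) * (1 * Complex.I)) t :=
    ((Complex.ofRealCLM.hasDerivAt (x := t)).mul_const Complex.I).cexp
  have h6 := h3.hasDerivAt.unique h5
  simp [h, Complex.exp_ne_zero] at h6

theorem injective_of_apply_ne_zero {V : Type*} [NormedAddCommGroup V] [NormedSpace ℝ V]
    (f : EuclideanSpace ℝ (Fin 1) →L[ℝ] V) {v : EuclideanSpace ℝ (Fin 1)} (hv : f v ≠ 0) :
    Function.Injective f := by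
  have h0 : v ≠ 0 := fun h ↦ hv (by rw [h, map_zero])
  refine (injective_iff_map_eq_zero f).2 fun x hx ↦ ?_
  obtain ⟨c, rfl⟩ := (finrank_eq_one_iff_of_nonzero' (K := ℝ) v h0).1 finrank_euclideanSpace_fin x
  rw [map_smul, smul_eq_zero] at hx
  rcases hx with hx | hx
  · rw [hx, zero_smul]
  · exact absurd hx hv

/-- A smooth loop is immersed at a point if and only if its derivative in a chart does not vanish
there. -/
theorem injective_mfderiv_iff {S : OrientedSurface}
    {e : OpenPartialHomeomorph S ℝ²} (he : e ∈ IsManifold.maximalAtlas (𝓡 2) ∞ S)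
    {L : Circle → S × ℝ} (hL : ContMDiff (𝓡 1) ((𝓡 2).prod 𝓘(ℝ, ℝ)) ∞ L) {t : ℝ}
    (ht : (L (Circle.exp t)).1 ∈ e.source) :
    Function.Injective (mfderiv (𝓡 1) ((𝓡 2).prod 𝓘(ℝ, ℝ)) L (Circle.exp t)) ↔
      deriv (localRep e L) t ≠ 0 := by
  obtain ⟨A, hA, hA1⟩ := exists_hasMFDerivAt_circleExp t
  obtain ⟨B, hB⟩ : ∃ B : EuclideanSpace ℝ (Fin 1) →L[ℝ] ℝ² × ℝ,
      HasMFDerivAt (𝓡 1) ((𝓡 2).prod 𝓘(ℝ, ℝ)) L (Circle.exp t) B :=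
    ⟨_, (hL.mdifferentiable (by simp) _).hasMFDerivAt⟩
  have hmf : mfderiv (𝓡 1) ((𝓡 2).prod 𝓘(ℝ, ℝ)) L (Circle.exp t) = B := hB.mfderiv
  rw [hmf]
  constructor
  · intro hi hd
    obtain ⟨D, hD⟩ : ∃ D : ℝ² × ℝ →L[ℝ] ℝ² × ℝ,
        HasMFDerivAt 𝓘(ℝ, ℝ² × ℝ) ((𝓡 2).prod 𝓘(ℝ, ℝ))
          (fun p : ℝ² × ℝ ↦ ((e.symm p.1, p.2) : S × ℝ)) (localRep e L t) D :=
      ⟨_, (((contMDiffOn_chart_symm_prod he).contMDiffAt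
        ((e.open_target.preimage continuous_fst).mem_nhds (e.map_source ht))).mdifferentiableAt
        (by simp)).hasMFDerivAt⟩
    have hr := ((contDiffAt_localRep he hL ht).differentiableAt (by simp)).hasDerivAt
    have heq : L ∘ Circle.exp =ᶠ[𝓝 t]
        (fun p : ℝ² × ℝ ↦ ((e.symm p.1, p.2) : S × ℝ)) ∘ localRep e L := by
      filter_upwards [(isOpen_localRep e hL.continuous).mem_nhds ht] with s hs
      exact (Prod.ext (e.left_inv hs) rfl : ((e.symm _, _) : S × ℝ) = _).symm
    have h1 : HasMFDerivAt 𝓘(ℝ, ℝ) ((𝓡 2).prod 𝓘(ℝ, ℝ)) (L ∘ Circle.exp) t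
        (D.comp (ContinuousLinearMap.toSpanSingleton ℝ (deriv (localRep e L) t))) :=
      (hD.comp t hr.hasFDerivAt.hasMFDerivAt).congr_of_eventuallyEq heq
    have h2 : B.comp A = D.comp (ContinuousLinearMap.toSpanSingleton ℝ (deriv (localRep e L) t)) :=
      hasMFDerivAt_unique (hB.comp t hA) h1
    have h3 : B (A 1) = 0 := by
      have := congrArg (fun f : ℝ →L[ℝ] ℝ² × ℝ ↦ f 1) h2
      simpa [hd] using this
    exact hA1 (hi (h3.trans (map_zero B).symm))
  · intro hd
    obtain ⟨D, hD⟩ : ∃ D : ℝ² × ℝ →L[ℝ] ℝ² × ℝ,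
        HasMFDerivAt ((𝓡 2).prod 𝓘(ℝ, ℝ)) 𝓘(ℝ, ℝ² × ℝ)
          (fun p : S × ℝ ↦ (e p.1, p.2)) (L (Circle.exp t)) D :=
      ⟨_, (((contMDiffOn_chart_prod he).contMDiffAt
        ((e.open_source.preimage continuous_fst).mem_nhds ht)).mdifferentiableAt
        (by simp)).hasMFDerivAt⟩
    have h1 : HasMFDerivAt 𝓘(ℝ, ℝ) 𝓘(ℝ, ℝ² × ℝ) (localRep e L) t (D.comp (B.comp A)) :=
      hD.comp t (hB.comp t hA)
    have h2 : HasFDerivAt (localRep e L) (D.comp (B.comp A)) t := h1.hasFDerivAt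
    refine injective_of_apply_ne_zero B (v := A 1) fun h ↦ hd ?_
    rw [h2.hasDerivAt.deriv]
    simp [h]

/-! ### Locally uniform `C¹` convergence of loops -/

/-- The family of loops `L`, read in the chart `e`, converges to `K` along `l` near the angle `t₀`,
uniformly and together with its derivative. Uniformity is expressed as convergence along the product
of `l` with the neighbourhood filter of `t₀`. -/
structure C1TendstoAt {S : OrientedSurface} {ι : Type*} (l : Filter ι) (L : ι → Circle → S × ℝ)
    (K : Circle → S × ℝ) (e : OpenPartialHomeomorph S ℝ²) (t₀ : ℝ) : Prop where
  mem_source : (K (Circle.exp t₀)).1 ∈ e.source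
  eventually_mem : ∀ᶠ p in l ×ˢ 𝓝 t₀, (L p.1 (Circle.exp p.2)).1 ∈ e.source
  tendsto : Tendsto (fun p : ι × ℝ ↦ localRep e (L p.1) p.2) (l ×ˢ 𝓝 t₀) (𝓝 (localRep e K t₀))
  tendsto_deriv : Tendsto (fun p : ι × ℝ ↦ deriv (localRep e (L p.1)) p.2) (l ×ˢ 𝓝 t₀)
    (𝓝 (deriv (localRep e K) t₀))

/-- The family of loops `L` converges to `K` along `l`, uniformly and together with its
derivative. -/
def C1Tendsto {S : OrientedSurface} {ι : Type*} (l : Filter ι) (L : ι → Circle → S × ℝ)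
    (K : Circle → S × ℝ) : Prop :=
  ∀ t₀ : ℝ, ∃ e ∈ IsManifold.maximalAtlas (𝓡 2) ∞ S, C1TendstoAt l L K e t₀

/-- The class of smooth loops in `S × ℝ`. -/
abbrev IsSmoothLoop {S : OrientedSurface} (L : Circle → S × ℝ) : Prop :=
  ContMDiff (𝓡 1) ((𝓡 2).prod 𝓘(ℝ, ℝ)) ∞ L

theorem contDiffOn_transition {S : OrientedSurface} {e e' : OpenPartialHomeomorph S ℝ²}
    (he : e ∈ IsManifold.maximalAtlas (𝓡 2) ∞ S) (he' : e' ∈ IsManifold.maximalAtlas (𝓡 2) ∞ S) :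
    ContDiffOn ℝ ∞ (fun p : ℝ² × ℝ ↦ (e' (e.symm p.1), p.2))
      (Prod.fst ⁻¹' (e.symm.trans e').source) := by
  refine ContMDiffOn.contDiffOn ((contMDiffOn_chart_prod he').comp
    ((contMDiffOn_chart_symm_prod he).mono fun p hp ↦ ?_) fun p hp ↦ ?_)
  · exact ((e.symm.trans_source e').subset hp).1
  · exact ((e.symm.trans_source e').subset hp).2

theorem localRep_eventuallyEq_transition {S : OrientedSurface} {e e' : OpenPartialHomeomorph S ℝ²}
    {L : Circle → S × ℝ} (hL : Continuous L) {t : ℝ} (ht : (L (Circle.exp t)).1 ∈ e.source) :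
    localRep e' L =ᶠ[𝓝 t] (fun p : ℝ² × ℝ ↦ (e' (e.symm p.1), p.2)) ∘ localRep e L := by
  filter_upwards [(isOpen_localRep e hL).mem_nhds ht] with s hs
  simp [localRep, e.left_inv hs]

theorem deriv_localRep_transition {S : OrientedSurface} {e e' : OpenPartialHomeomorph S ℝ²}
    (he : e ∈ IsManifold.maximalAtlas (𝓡 2) ∞ S) (he' : e' ∈ IsManifold.maximalAtlas (𝓡 2) ∞ S)
    {L : Circle → S × ℝ} (hL : IsSmoothLoop L) {t : ℝ}
    (ht : (L (Circle.exp t)).1 ∈ e.source) (ht' : (L (Circle.exp t)).1 ∈ e'.source) :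
    deriv (localRep e' L) t = fderiv ℝ (fun p : ℝ² × ℝ ↦ (e' (e.symm p.1), p.2))
      (localRep e L t) (deriv (localRep e L) t) := by
  rw [(localRep_eventuallyEq_transition hL.continuous ht).deriv_eq]
  have h1 : DifferentiableAt ℝ (fun p : ℝ² × ℝ ↦ (e' (e.symm p.1), p.2)) (localRep e L t) := by
    refine ((contDiffOn_transition he he').contDiffAt (((e.symm.trans e').open_source.preimage
      continuous_fst).mem_nhds ?_)).differentiableAt (by simp)
    simp [localRep, e.map_source ht, e.left_inv ht, ht']
  exact (HasFDerivAt.comp_hasDerivAt t h1.hasFDerivAt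
    ((contDiffAt_localRep he hL ht).differentiableAt (by simp)).hasDerivAt).deriv

/-- `C¹` convergence does not depend on the chart. -/
theorem C1TendstoAt.change_chart {S : OrientedSurface} {ι : Type*} {l : Filter ι}
    {L : ι → Circle → S × ℝ} {K : Circle → S × ℝ} {e e' : OpenPartialHomeomorph S ℝ²} {t₀ : ℝ}
    (h : C1TendstoAt l L K e t₀) (hL : ∀ᶠ a in l, IsSmoothLoop (L a)) (hK : IsSmoothLoop K)
    (he : e ∈ IsManifold.maximalAtlas (𝓡 2) ∞ S) (he' : e' ∈ IsManifold.maximalAtlas (𝓡 2) ∞ S)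
    (hmem : (K (Circle.exp t₀)).1 ∈ e'.source) : C1TendstoAt l L K e' t₀ := by
  set g := fun p : ℝ² × ℝ ↦ (e' (e.symm p.1), p.2) with hg
  set Ω : Set (ℝ² × ℝ) := Prod.fst ⁻¹' (e.symm.trans e').source
  have hΩ : IsOpen Ω := (e.symm.trans e').open_source.preimage continuous_fst
  have hgs : ContDiffOn ℝ ∞ g Ω := contDiffOn_transition he he'
  have hx : localRep e K t₀ ∈ Ω := by
    simp [Ω, localRep, e.map_source h.mem_source, e.left_inv h.mem_source, hmem]
  have hmem' : ∀ᶠ p in l ×ˢ 𝓝 t₀, (L p.1 (Circle.exp p.2)).1 ∈ e'.source := by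
    filter_upwards [h.eventually_mem, h.tendsto.eventually (hΩ.mem_nhds hx)] with p hp hp'
    have : e.symm (e (L p.1 (Circle.exp p.2)).1) ∈ e'.source :=
      ((e.symm.trans_source e').subset hp').2
    rwa [e.left_inv hp] at this
  have hL' : ∀ᶠ p in l ×ˢ 𝓝 t₀, IsSmoothLoop (L p.1) := hL.prod_inl _
  refine ⟨hmem, hmem', ?_, ?_⟩
  · have h1 := ((hgs.continuousOn.continuousAt (hΩ.mem_nhds hx)).tendsto.comp h.tendsto)
    rw [(localRep_eventuallyEq_transition hK.continuous h.mem_source).eq_of_nhds]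
    refine h1.congr' ?_
    filter_upwards [h.eventually_mem] with p hp
    simp [localRep, g, e.left_inv hp]
  · have h1 : ContinuousAt (fderiv ℝ g) (localRep e K t₀) :=
      (hgs.continuousOn_fderiv_of_isOpen hΩ (by simp)).continuousAt (hΩ.mem_nhds hx)
    have h2 := (isBoundedBilinearMap_apply (𝕜 := ℝ) (E := ℝ² × ℝ)
      (F := ℝ² × ℝ)).continuous.continuousAt |>.tendsto.comp ((h1.tendsto.comp h.tendsto).prodMk_nhds h.tendsto_deriv)
    rw [deriv_localRep_transition he he' hK h.mem_source hmem]
    refine h2.congr' ?_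
    filter_upwards [h.eventually_mem, hmem', hL'] with p hp hp' hs
    exact (deriv_localRep_transition he he' hs hp hp').symm

theorem C1Tendsto.at {S : OrientedSurface} {ι : Type*} {l : Filter ι}
    {L : ι → Circle → S × ℝ} {K : Circle → S × ℝ} {e : OpenPartialHomeomorph S ℝ²} {t₀ : ℝ}
    (h : C1Tendsto l L K) (hL : ∀ᶠ a in l, IsSmoothLoop (L a)) (hK : IsSmoothLoop K)
    (he : e ∈ IsManifold.maximalAtlas (𝓡 2) ∞ S)
    (hmem : (K (Circle.exp t₀)).1 ∈ e.source) : C1TendstoAt l L K e t₀ := by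
  obtain ⟨e', he', h'⟩ := h t₀
  exact h'.change_chart hL hK he' he hmem

theorem C1TendstoAt.comp {S : OrientedSurface} {ι κ : Type*} {l : Filter ι} {m : Filter κ}
    {L : ι → Circle → S × ℝ} {K : Circle → S × ℝ} {e : OpenPartialHomeomorph S ℝ²} {t₀ : ℝ}
    (h : C1TendstoAt l L K e t₀) {φ : κ → ι} (hφ : Tendsto φ m l) :
    C1TendstoAt m (fun b ↦ L (φ b)) K e t₀ :=
  have h1 : Tendsto (Prod.map φ (id : ℝ → ℝ)) (m ×ˢ 𝓝 t₀) (l ×ˢ 𝓝 t₀) := hφ.prodMap tendsto_id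
  ⟨h.mem_source, h1.eventually h.eventually_mem, h.tendsto.comp h1, h.tendsto_deriv.comp h1⟩

theorem circleExp_surjective (z : Circle) : ∃ t, Circle.exp t = z :=
  ⟨_, Circle.exp_arg z⟩

theorem nhds_circleExp (t : ℝ) : 𝓝 (Circle.exp t) = map Circle.exp (𝓝 t) :=
  (isLocalHomeomorph_circleExp.map_nhds_eq t).symm

theorem C1Tendsto.tendsto {S : OrientedSurface} {ι : Type*} {l : Filter ι}
    {L : ι → Circle → S × ℝ} {K : Circle → S × ℝ} (h : C1Tendsto l L K) (z : Circle) :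
    Tendsto (fun p : ι × Circle ↦ L p.1 p.2) (l ×ˢ 𝓝 z) (𝓝 (K z)) := by
  obtain ⟨t, rfl⟩ := circleExp_surjective z
  obtain ⟨e, he, ht⟩ := h t
  have h1 : l ×ˢ 𝓝 (Circle.exp t) = map (Prod.map id Circle.exp) (l ×ˢ 𝓝 t) := by
    rw [nhds_circleExp, ← Filter.prod_map_map_eq', Filter.map_id]
  rw [h1, tendsto_map'_iff]
  have h2 : ContinuousAt (fun p : ℝ² × ℝ ↦ (e.symm p.1, p.2)) (localRep e K t) :=
    (ContinuousAt.comp (g := e.symm) (f := Prod.fst)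
      (e.continuousAt_symm (e.map_source ht.mem_source)) continuousAt_fst).prodMk continuousAt_snd
  have h3 := h2.tendsto.comp ht.tendsto
  have h4 : (e.symm (localRep e K t).1, (localRep e K t).2) = K (Circle.exp t) :=
    Prod.ext (e.left_inv ht.mem_source) rfl
  rw [h4] at h3
  refine h3.congr' ?_
  filter_upwards [ht.eventually_mem] with p hp
  exact Prod.ext (e.left_inv hp) rfl

theorem eventually_forall_of_isCompact {ι Y : Type*} [TopologicalSpace Y] {l : Filter ι}
    {P : ι → Y → Prop} {Z : Set Y} (hZ : IsCompact Z)
    (h : ∀ z ∈ Z, ∀ᶠ p in l ×ˢ 𝓝 z, P p.1 p.2) : ∀ᶠ a in l, ∀ z ∈ Z, P a z :=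
  (show ∀ᶠ p in l ×ˢ 𝓝ˢ Z, P p.1 p.2 from hZ.mem_prod_nhdsSet_of_forall h).curry.mono
    fun _ h ↦ h.self_of_nhdsSet

theorem C1Tendsto.eventually_forall_mem {S : OrientedSurface} {ι : Type*} {l : Filter ι}
    {L : ι → Circle → S × ℝ} {K : Circle → S × ℝ} (h : C1Tendsto l L K) {Z : Set Circle}
    (hZ : IsCompact Z) {O : Set S} (hO : IsOpen O) (hK : ∀ z ∈ Z, (K z).1 ∈ O) :
    ∀ᶠ a in l, ∀ z ∈ Z, (L a z).1 ∈ O :=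
  eventually_forall_of_isCompact hZ fun z hz ↦
    (h.tendsto z).eventually ((hO.preimage continuous_fst).mem_nhds (hK z hz))

/-- Near a point where `K` is immersed, the loops close to `K` are injective. -/
theorem C1TendstoAt.eventually_injOn {S : OrientedSurface} {ι : Type*} {l : Filter ι}
    {L : ι → Circle → S × ℝ} {K : Circle → S × ℝ} {e : OpenPartialHomeomorph S ℝ²} {t₀ : ℝ}
    (h : C1TendstoAt l L K e t₀) (hL : ∀ᶠ a in l, IsSmoothLoop (L a))
    (he : e ∈ IsManifold.maximalAtlas (𝓡 2) ∞ S) (hd : deriv (localRep e K) t₀ ≠ 0) :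
    ∃ U ∈ 𝓝 t₀, ∀ᶠ a in l, InjOn (fun t ↦ L a (Circle.exp t)) U := by
  set v := deriv (localRep e K) t₀
  have hv : 0 < ‖v‖ / 2 := by positivity
  obtain ⟨A, hA, B, hB, hAB⟩ := eventually_prod_iff.1
    (h.eventually_mem.and (h.tendsto_deriv.eventually (Metric.ball_mem_nhds v hv)))
  obtain ⟨δ, hδ, hδB⟩ := Metric.eventually_nhds_iff_ball.1 hB
  refine ⟨Metric.ball t₀ δ, Metric.ball_mem_nhds _ hδ, ?_⟩
  filter_upwards [hA, hL] with a ha hs x hx y hy hxy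
  by_contra hne
  -- subtracting `s • v` leaves a map with Lipschitz constant `‖v‖ / 2`
  have h1 : ∀ s ∈ Metric.ball t₀ δ, HasDerivWithinAt (fun s ↦ localRep e (L a) s - s • v)
      (deriv (localRep e (L a)) s - (1 : ℝ) • v) (Metric.ball t₀ δ) s := fun s hs' ↦
    (((contDiffAt_localRep he hs (hAB ha (hδB s hs')).1).differentiableAt
      (by simp)).hasDerivAt.sub ((hasDerivAt_id s).smul_const v)).hasDerivWithinAt
  have h2 := (convex_ball t₀ δ).norm_image_sub_le_of_norm_hasDerivWithin_le (C := ‖v‖ / 2) h1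
    (fun s hs' ↦ by
      have := (hAB ha (hδB s hs')).2
      rw [one_smul, ← dist_eq_norm]
      exact le_of_lt this) hx hy
  have h3 : localRep e (L a) x = localRep e (L a) y := by
    have hxy' : L a (Circle.exp x) = L a (Circle.exp y) := hxy
    simp [localRep, hxy']
  have h4 : localRep e (L a) y - y • v - (localRep e (L a) x - x • v) = -((y - x) • v) := by
    rw [h3, sub_smul]; abel
  rw [h4, norm_neg, norm_smul] at h2
  have h5 : 0 < ‖y - x‖ := norm_pos_iff.2 (sub_ne_zero.2 (Ne.symm hne))
  nlinarith

/-- Loops that are `C¹`-close to a knot are knots. -/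
theorem C1Tendsto.eventually_knot {S : OrientedSurface} {ι : Type*} {l : Filter ι}
    {L : ι → Circle → S × ℝ} (K : Knot S) (h : C1Tendsto l L K.toFun)
    (hL : ∀ᶠ a in l, IsSmoothLoop (L a)) : ∀ᶠ a in l, ∃ J : Knot S, J.toFun = L a := by
  have himm : ∀ᶠ a in l, ∀ z ∈ (univ : Set Circle),
      Function.Injective (mfderiv (𝓡 1) ((𝓡 2).prod 𝓘(ℝ, ℝ)) (L a) z) := by
    refine eventually_forall_of_isCompact isCompact_univ fun z _ ↦ ?_
    obtain ⟨t, rfl⟩ := circleExp_surjective z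
    obtain ⟨e, he, ht⟩ := h t
    have hd := (injective_mfderiv_iff he K.contMDiff ht.mem_source).1 (K.injective_mfderiv _)
    have h1 : l ×ˢ 𝓝 (Circle.exp t) = map (Prod.map id Circle.exp) (l ×ˢ 𝓝 t) := by
      rw [nhds_circleExp, ← Filter.prod_map_map_eq', Filter.map_id]
    rw [h1, eventually_map]
    filter_upwards [ht.eventually_mem, ht.tendsto_deriv.eventually_ne hd, hL.prod_inl _]
      with p hp hp' hs
    exact (injective_mfderiv_iff he hs hp).2 hp'
  have hinj : ∀ᶠ a in l, ∀ q ∈ (univ : Set (Circle × Circle)), L a q.1 = L a q.2 → q.1 = q.2 := by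
    refine eventually_forall_of_isCompact isCompact_univ fun ⟨z, z'⟩ _ ↦ ?_
    -- on the diagonal immersedness gives injectivity, off the diagonal the images are separated
    by_cases hz : z = z'
    · obtain ⟨t, rfl⟩ := circleExp_surjective z
      subst hz
      obtain ⟨e, he, ht⟩ := h t
      have hd := (injective_mfderiv_iff he K.contMDiff ht.mem_source).1 (K.injective_mfderiv _)
      obtain ⟨U, hU, hLU⟩ := ht.eventually_injOn hL he hd
      have hU' : Circle.exp '' U ∈ 𝓝 (Circle.exp t) := by
        rw [nhds_circleExp]
        exact image_mem_map hU
      filter_upwards [hLU.prod_mk (prod_mem_nhds hU' hU')] with ⟨a, q, q'⟩ ⟨h1, h2, h3⟩ h4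
      obtain ⟨x, hx, rfl⟩ := h2
      obtain ⟨y, hy, rfl⟩ := h3
      exact congrArg Circle.exp (h1 hx hy h4)
    · have hne : K.toFun z ≠ K.toFun z' := fun h' ↦ hz (K.isEmbedding.injective h')
      have h1 : Tendsto (fun p : ι × Circle × Circle ↦ L p.1 p.2.1) (l ×ˢ 𝓝 (z, z'))
          (𝓝 (K.toFun z)) :=
        (h.tendsto z).comp (tendsto_id.prodMap (continuous_fst.tendsto (z, z')))
      have h2 : Tendsto (fun p : ι × Circle × Circle ↦ L p.1 p.2.2) (l ×ˢ 𝓝 (z, z'))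
          (𝓝 (K.toFun z')) :=
        (h.tendsto z').comp (tendsto_id.prodMap (continuous_snd.tendsto (z, z')))
      filter_upwards [(h1.prodMk_nhds h2).eventually
        (isClosed_diagonal.isOpen_compl.mem_nhds hne)] with p hp hp'
      exact absurd hp' hp
  filter_upwards [himm, hinj, hL] with a h1 h2 h3
  refine ⟨⟨L a, h3, fun z ↦ h1 z trivial, ?_⟩, rfl⟩
  exact (h3.continuous.isClosedEmbedding fun x y hxy ↦ h2 (x, y) trivial hxy).isEmbedding

/-! ### Interpolation of loops in a chart -/

/-- The loop which moves, where the cut-off function `ρ` is nonzero, from `L` towards `M` along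
segments in the chart `e`. The time `s` ranges over the whole line and acts through
`Real.smoothTransition`, so that the family is constant outside `[0, 1]`. -/
noncomputable def interpolate {S : OrientedSurface} (e : OpenPartialHomeomorph S ℝ²)
    (ρ : Circle → ℝ) (L M : Circle → S × ℝ) (s : ℝ) (z : Circle) : S × ℝ :=
  open Classical in
  if ρ z = 0 then L z else
    (e.symm (e (L z).1 + (s.smoothTransition * ρ z) • (e (M z).1 - e (L z).1)),
      (L z).2 + (s.smoothTransition * ρ z) • ((M z).2 - (L z).2))

section

variable {S : OrientedSurface} {e : OpenPartialHomeomorph S ℝ²} {ρ : Circle → ℝ}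
  {L M : Circle → S × ℝ}

theorem interpolate_of_mem (s : ℝ) {z : Circle} (hz : (L z).1 ∈ e.source) :
    interpolate e ρ L M s z =
      (e.symm (e (L z).1 + (s.smoothTransition * ρ z) • (e (M z).1 - e (L z).1)),
        (L z).2 + (s.smoothTransition * ρ z) • ((M z).2 - (L z).2)) := by
  unfold interpolate
  split_ifs with h
  · simp [h, e.left_inv hz]
  · rfl

theorem interpolate_of_notMem_tsupport (s : ℝ) {z : Circle} (hz : z ∉ tsupport ρ) :
    interpolate e ρ L M s z = L z :=
  if_pos (image_eq_zero_of_notMem_tsupport hz)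

theorem interpolate_zero (h : ∀ z ∈ tsupport ρ, (L z).1 ∈ e.source) :
    interpolate e ρ L M 0 = L := by
  funext z
  by_cases hz : z ∈ tsupport ρ
  · simp [interpolate_of_mem _ (h z hz), e.left_inv (h z hz)]
  · exact interpolate_of_notMem_tsupport _ hz

theorem interpolate_one {z : Circle} (hz : ρ z = 1) (hL : (L z).1 ∈ e.source)
    (hM : (M z).1 ∈ e.source) : interpolate e ρ L M 1 z = M z := by
  simp [interpolate_of_mem _ hL, hz, e.left_inv hM]

theorem interpolate_of_eq (s : ℝ) (h : ∀ z ∈ tsupport ρ, (L z).1 ∈ e.source) {z : Circle}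
    (hz : L z = M z) : interpolate e ρ L M s z = M z := by
  by_cases hz' : z ∈ tsupport ρ
  · have := h z hz'
    rw [hz] at this
    simp [interpolate_of_mem _ (h z hz'), hz, e.left_inv this]
  · rw [interpolate_of_notMem_tsupport _ hz', hz]

theorem add_smul_mem_target (hconv : Convex ℝ e.target) (hρ : ∀ z, ρ z ∈ Icc (0 : ℝ) 1) (s : ℝ)
    {z : Circle} (hL : (L z).1 ∈ e.source) (hM : (M z).1 ∈ e.source) :
    e (L z).1 + (s.smoothTransition * ρ z) • (e (M z).1 - e (L z).1) ∈ e.target :=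
  hconv.add_smul_sub_mem (e.map_source hL) (e.map_source hM)
    ⟨mul_nonneg (Real.smoothTransition.nonneg s) (hρ z).1,
      mul_le_one₀ (Real.smoothTransition.le_one s) (hρ z).1 (hρ z).2⟩

theorem localRep_interpolate (hconv : Convex ℝ e.target) (hρ : ∀ z, ρ z ∈ Icc (0 : ℝ) 1) (s : ℝ)
    {t : ℝ} (hL : (L (Circle.exp t)).1 ∈ e.source) (hM : (M (Circle.exp t)).1 ∈ e.source) :
    localRep e (interpolate e ρ L M s) t = localRep e L t +
      (s.smoothTransition * ρ (Circle.exp t)) • (localRep e M t - localRep e L t) := by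
  rw [localRep, interpolate_of_mem _ hL, e.right_inv (add_smul_mem_target hconv hρ s hL hM)]
  rfl

theorem contMDiff_interpolate (he : e ∈ IsManifold.maximalAtlas (𝓡 2) ∞ S)
    (hconv : Convex ℝ e.target) (hρ : ∀ z, ρ z ∈ Icc (0 : ℝ) 1)
    (hρs : ContMDiff (𝓡 1) 𝓘(ℝ, ℝ) ∞ ρ) (hL : IsSmoothLoop L) (hM : IsSmoothLoop M)
    (h : ∀ z ∈ tsupport ρ, (L z).1 ∈ e.source ∧ (M z).1 ∈ e.source) :
    ContMDiff (𝓘(ℝ, ℝ).prod (𝓡 1)) ((𝓡 2).prod 𝓘(ℝ, ℝ)) ∞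
      (fun p : ℝ × Circle ↦ interpolate e ρ L M p.1 p.2) := by
  rintro ⟨s, z⟩
  by_cases hz : z ∈ tsupport ρ
  · set O : Set (ℝ × Circle) := {p | (L p.2).1 ∈ e.source ∧ (M p.2).1 ∈ e.source}
    have hO : IsOpen O :=
      (e.open_source.preimage (continuous_fst.comp (hL.continuous.comp continuous_snd))).inter
        (e.open_source.preimage (continuous_fst.comp (hM.continuous.comp continuous_snd)))
    have hrep : ∀ N : Circle → S × ℝ, IsSmoothLoop N → (∀ p ∈ O, (N p.2).1 ∈ e.source) →
        ContMDiffOn (𝓘(ℝ, ℝ).prod (𝓡 1)) 𝓘(ℝ, ℝ² × ℝ) ∞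
          (fun p : ℝ × Circle ↦ (e (N p.2).1, (N p.2).2)) O := fun N hN hNO ↦
      (contMDiffOn_chart_prod he).comp (hN.comp contMDiff_snd).contMDiffOn hNO
    have h1 := hrep L hL fun p hp ↦ hp.1
    have h2 := hrep M hM fun p hp ↦ hp.2
    have h3 : ContMDiff (𝓘(ℝ, ℝ).prod (𝓡 1)) 𝓘(ℝ, ℝ) ∞
        (fun p : ℝ × Circle ↦ p.1.smoothTransition * ρ p.2) :=
      (Real.smoothTransition.contDiff.contMDiff.comp contMDiff_fst).mul (hρs.comp contMDiff_snd)
    have h4 := h1.add (h3.contMDiffOn.smul (h2.sub h1))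
    have h5 := (contMDiffOn_chart_symm_prod he).comp h4
      fun p hp ↦ add_smul_mem_target hconv hρ p.1 hp.1 hp.2
    refine (h5.contMDiffAt (hO.mem_nhds (h z hz))).congr_of_eventuallyEq ?_
    filter_upwards [hO.mem_nhds (show (s, z) ∈ O from h z hz)] with p hp
    rw [interpolate_of_mem _ hp.1]
    rfl
  · have h1 : ContMDiffAt (𝓘(ℝ, ℝ).prod (𝓡 1)) ((𝓡 2).prod 𝓘(ℝ, ℝ)) ∞
        (fun p : ℝ × Circle ↦ L p.2) (s, z) := (hL.comp contMDiff_snd) _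
    refine h1.congr_of_eventuallyEq ?_
    filter_upwards [((isClosed_tsupport ρ).isOpen_compl.preimage continuous_snd).mem_nhds
      (show (s, z) ∈ Prod.snd ⁻¹' (tsupport ρ)ᶜ from hz)] with p hp
    exact interpolate_of_notMem_tsupport _ hp

end

theorem tendsto_add_smul_sub {ι V : Type*} [NormedAddCommGroup V] [NormedSpace ℝ V] {l : Filter ι}
    {f g : ι → V} {x : V} {c : ι → ℝ} (hf : Tendsto f l (𝓝 x)) (hg : Tendsto g l (𝓝 x))
    (hc : IsBoundedUnder (· ≤ ·) l (norm ∘ c)) :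
    Tendsto (fun i ↦ f i + c i • (g i - f i)) l (𝓝 x) := by
  have h1 : Tendsto (fun i ↦ g i - f i) l (𝓝 0) := by simpa using hg.sub hf
  simpa using hf.add (hc.smul_tendsto_zero h1)

/-- Loops obtained by interpolation between loops `C¹`-close to `K` are `C¹`-close to `K`, uniformly
in the time parameter. -/
theorem C1Tendsto.interpolate {S : OrientedSurface} {e : OpenPartialHomeomorph S ℝ²}
    {ρ : Circle → ℝ} {ι : Type*} {l : Filter ι} {L M : ι → Circle → S × ℝ} {K : Circle → S × ℝ}
    (he : e ∈ IsManifold.maximalAtlas (𝓡 2) ∞ S)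
    (hconv : Convex ℝ e.target) (hρ : ∀ z, ρ z ∈ Icc (0 : ℝ) 1)
    (hρs : ContMDiff (𝓡 1) 𝓘(ℝ, ℝ) ∞ ρ) (hK : IsSmoothLoop K)
    (hKe : ∀ z ∈ tsupport ρ, (K z).1 ∈ e.source)
    (hL : C1Tendsto l L K) (hLs : ∀ᶠ a in l, IsSmoothLoop (L a))
    (hM : C1Tendsto l M K) (hMs : ∀ᶠ a in l, IsSmoothLoop (M a)) :
    C1Tendsto (l ×ˢ ⊤) (fun p : ι × ℝ ↦ VirtualKnot.interpolate e ρ (L p.1) (M p.1) p.2) K := by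
  intro t
  by_cases ht : Circle.exp t ∈ tsupport ρ
  · refine ⟨e, he, ?_⟩
    have hL' := (hL.at hLs hK he (hKe _ ht)).comp (tendsto_fst (f := l) (g := (⊤ : Filter ℝ)))
    have hM' := (hM.at hMs hK he (hKe _ ht)).comp (tendsto_fst (f := l) (g := (⊤ : Filter ℝ)))
    have hs := ((hLs.and hMs).prod_inl (⊤ : Filter ℝ)).prod_inl (𝓝 t)
    have hσ : ContDiff ℝ ∞ (fun u : ℝ ↦ ρ (Circle.exp u)) :=
      (hρs.comp contMDiff_circleExp).contDiff
    have hb : ∀ p : (ι × ℝ) × ℝ, |p.1.2.smoothTransition| ≤ 1 := fun p ↦ by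
      rw [abs_of_nonneg (Real.smoothTransition.nonneg _)]
      exact Real.smoothTransition.le_one _
    have hb1 : IsBoundedUnder (· ≤ ·) ((l ×ˢ (⊤ : Filter ℝ)) ×ˢ 𝓝 t)
        (norm ∘ fun p : (ι × ℝ) × ℝ ↦ p.1.2.smoothTransition * ρ (Circle.exp p.2)) := by
      refine isBoundedUnder_of ⟨1, fun p ↦ ?_⟩
      rw [Function.comp_apply, norm_mul, Real.norm_eq_abs, Real.norm_eq_abs,
        abs_of_nonneg (hρ _).1]
      exact mul_le_one₀ (hb p) (hρ _).1 (hρ _).2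
    have hb2 : IsBoundedUnder (· ≤ ·) ((l ×ˢ (⊤ : Filter ℝ)) ×ˢ 𝓝 t)
        (norm ∘ fun p : (ι × ℝ) × ℝ ↦
          p.1.2.smoothTransition * deriv (fun u : ℝ ↦ ρ (Circle.exp u)) p.2) := by
      have h1 : Tendsto (fun p : (ι × ℝ) × ℝ ↦ ‖deriv (fun u : ℝ ↦ ρ (Circle.exp u)) p.2‖)
          ((l ×ˢ (⊤ : Filter ℝ)) ×ˢ 𝓝 t) (𝓝 ‖deriv (fun u : ℝ ↦ ρ (Circle.exp u)) t‖) :=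
        ((hσ.continuous_deriv (by simp)).norm.tendsto t).comp tendsto_snd
      refine h1.isBoundedUnder_le.mono_le (Eventually.of_forall fun p ↦ ?_)
      rw [Function.comp_apply, norm_mul]
      exact mul_le_of_le_one_left (norm_nonneg _) (hb p)
    -- near `t`, the interpolation is given by the formula in the chart
    have hrep : ∀ᶠ p in (l ×ˢ (⊤ : Filter ℝ)) ×ˢ 𝓝 t,
        localRep e (VirtualKnot.interpolate e ρ (L p.1.1) (M p.1.1) p.1.2) =ᶠ[𝓝 p.2]
          fun u ↦ localRep e (L p.1.1) u + (p.1.2.smoothTransition * ρ (Circle.exp u)) •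
            (localRep e (M p.1.1) u - localRep e (L p.1.1) u) := by
      filter_upwards [hL'.eventually_mem, hM'.eventually_mem, hs] with p h1 h2 h3
      filter_upwards [(isOpen_localRep e h3.1.continuous).mem_nhds h1,
        (isOpen_localRep e h3.2.continuous).mem_nhds h2] with u hu hu'
      exact localRep_interpolate hconv hρ _ hu hu'
    refine ⟨hKe _ ht, ?_, ?_, ?_⟩
    · filter_upwards [hL'.eventually_mem, hM'.eventually_mem] with p h1 h2
      rw [interpolate_of_mem _ h1]
      exact e.map_target (add_smul_mem_target hconv hρ _ h1 h2)
    · refine (tendsto_add_smul_sub hL'.tendsto hM'.tendsto hb1).congr' ?_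
      filter_upwards [hrep] with p hp
      exact hp.eq_of_nhds.symm
    · have h0 : Tendsto (fun p : (ι × ℝ) × ℝ ↦ localRep e (M p.1.1) p.2 - localRep e (L p.1.1) p.2)
          ((l ×ˢ (⊤ : Filter ℝ)) ×ˢ 𝓝 t) (𝓝 0) := by
        simpa using hM'.tendsto.sub hL'.tendsto
      have h1 := (tendsto_add_smul_sub hL'.tendsto_deriv hM'.tendsto_deriv hb1).add
        (hb2.smul_tendsto_zero h0)
      rw [add_zero] at h1
      refine h1.congr' ?_
      filter_upwards [hrep, hL'.eventually_mem, hM'.eventually_mem, hs] with p hp h2 h3 h4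
      have hl := ((contDiffAt_localRep he h4.1 h2).differentiableAt (by simp)).hasDerivAt
      have hm := ((contDiffAt_localRep he h4.2 h3).differentiableAt (by simp)).hasDerivAt
      have hr := (hσ.differentiable (by simp) p.2).hasDerivAt
      rw [hp.deriv_eq,
        (hl.fun_add ((hr.const_mul p.1.2.smoothTransition).fun_smul (hm.fun_sub hl))).deriv]
      simp only [add_assoc]
  · obtain ⟨e', he', h⟩ := hL t
    have hL' := h.comp (tendsto_fst (f := l) (g := (⊤ : Filter ℝ)))
    have hO : IsOpen (Circle.exp ⁻¹' (tsupport ρ)ᶜ) :=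
      (isClosed_tsupport ρ).isOpen_compl.preimage Circle.exp.continuous
    have hrep : ∀ᶠ p : (ι × ℝ) × ℝ in (l ×ˢ (⊤ : Filter ℝ)) ×ˢ 𝓝 t, ∀ᶠ u in 𝓝 p.2,
        VirtualKnot.interpolate e ρ (L p.1.1) (M p.1.1) p.1.2 (Circle.exp u) =
          L p.1.1 (Circle.exp u) := by
      have h1 : ∀ᶠ u in 𝓝 t, u ∈ Circle.exp ⁻¹' (tsupport ρ)ᶜ := hO.mem_nhds ht
      filter_upwards [h1.prod_inr (l ×ˢ (⊤ : Filter ℝ))] with p hp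
      filter_upwards [hO.mem_nhds hp] with u hu
      exact interpolate_of_notMem_tsupport _ hu
    refine ⟨e', he', h.mem_source, ?_, ?_, ?_⟩
    · filter_upwards [hrep, hL'.eventually_mem] with p hp h1
      rwa [hp.self_of_nhds]
    · refine hL'.tendsto.congr' ?_
      filter_upwards [hrep] with p hp
      rw [localRep, localRep, hp.self_of_nhds]
    · refine hL'.tendsto_deriv.congr' ?_
      filter_upwards [hrep] with p hp
      refine EventuallyEq.deriv_eq ?_
      filter_upwards [hp] with u hu
      rw [localRep, localRep, hu]

/-! ### Local path connectedness of the space of knots -/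

/-- The `C^∞` topology is finer than the `C¹` topology. -/
theorem c1Tendsto_nhds {S : OrientedSurface} (K : Knot S) :
    C1Tendsto (𝓝 K) Knot.toFun K.toFun := by
  intro t
  set e := chartAt ℝ² (K.toFun (Circle.exp t)).1
  have he : e ∈ IsManifold.maximalAtlas (𝓡 2) ∞ S :=
    IsManifold.chart_mem_maximalAtlas _
  have ht : (K.toFun (Circle.exp t)).1 ∈ e.source := mem_chart_source _ _
  have hjet : ∀ k, Tendsto (fun p : Knot S × ℝ ↦ p.1.jet e p.2 k) (𝓝 K ×ˢ 𝓝 t)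
      (𝓝 (K.jet e t k)) ∧
      ∀ᶠ p in 𝓝 K ×ˢ 𝓝 t, ((p : Knot S × ℝ).1.toFun (Circle.exp p.2)).1 ∈ e.source := by
    intro k
    have h1 : ContDiffOn ℝ ∞ (fun p : ℝ × ℝ ↦ iteratedDeriv k (localRep e K.toFun) p.2)
        {p : ℝ × ℝ | (K.toFun (Circle.exp p.2)).1 ∈ e.source} :=
      contDiffOn_iteratedDeriv_partial ((isOpen_localRep e K.contMDiff.continuous).preimage
        continuous_snd) ((contDiffOn_localRep he K.contMDiff).comp contDiff_snd.contDiffOn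
          fun p hp ↦ hp) k
    have h2 : ContinuousAt (iteratedDeriv k (localRep e K.toFun)) t :=
      ContinuousAt.comp (f := fun t : ℝ ↦ (t, t))
        (h1.continuousOn.continuousAt (x := (t, t))
        (((isOpen_localRep e K.contMDiff.continuous).preimage continuous_snd).mem_nhds ht))
        (by fun_prop)
    have h3 : ∀ W ∈ 𝓝 (K.jet e t k), ∀ᶠ p in 𝓝 K ×ˢ 𝓝 t,
        ((p : Knot S × ℝ).1.toFun (Circle.exp p.2)).1 ∈ e.source ∧ p.1.jet e p.2 k ∈ W := by
      intro W hW
      obtain ⟨W', hW', hWo, hWm⟩ := mem_nhds_iff.1 hW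
      have h4 : ∀ᶠ u in 𝓝 t, (K.toFun (Circle.exp u)).1 ∈ e.source ∧ K.jet e u k ∈ W' :=
        inter_mem ((isOpen_localRep e K.contMDiff.continuous).mem_nhds ht)
          (h2.preimage_mem_nhds (hWo.mem_nhds hWm))
      obtain ⟨C, hC, hCs, hCc⟩ := local_compact_nhds h4
      have h5 : IsOpen {J : Knot S | ∀ u ∈ C, (J.toFun (Circle.exp u)).1 ∈ e.source ∧
          J.jet e u ∈ (fun j ↦ j k) ⁻¹' W'} :=
        isOpen_generateFrom_of_mem ⟨e, he, C, hCc, _, hWo.preimage (continuous_apply k), rfl⟩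
      filter_upwards [prod_mem_prod (h5.mem_nhds fun u hu ↦ hCs hu) hC] with p hp
      exact ⟨(hp.1 _ hp.2).1, hW' (hp.1 _ hp.2).2⟩
    exact ⟨fun W hW ↦ (h3 W hW).mono fun _ h ↦ h.2, (h3 univ univ_mem).mono fun _ h ↦ h.1⟩
  refine ⟨e, he, ht, (hjet 0).2, ?_, ?_⟩
  · simpa [Knot.jet] using! (hjet 0).1
  · simpa [Knot.jet] using! (hjet 1).1

theorem exists_chart_convex_target {S : OrientedSurface} (x : S) :
    ∃ e ∈ IsManifold.maximalAtlas (𝓡 2) ∞ S, x ∈ e.source ∧ Convex ℝ e.target := by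
  set c := chartAt ℝ² x
  obtain ⟨r, hr, hrc⟩ := Metric.mem_nhds_iff.1
    (c.open_target.mem_nhds (c.map_source (mem_chart_source ℝ² x)))
  have hU : IsOpen (c.source ∩ c ⁻¹' Metric.ball (c x) r) :=
    c.isOpen_inter_preimage Metric.isOpen_ball
  refine ⟨c.restr _, restr_mem_maximalAtlas (contDiffGroupoid ∞ (𝓡 2))
    (IsManifold.chart_mem_maximalAtlas x) hU, ?_, ?_⟩
  · rw [c.restr_source' _ hU]
    exact ⟨mem_chart_source ℝ² x, mem_chart_source ℝ² x, Metric.mem_ball_self hr⟩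
  · have : (c.restr (c.source ∩ c ⁻¹' Metric.ball (c x) r)).target = Metric.ball (c x) r := by
      rw [c.restr_target, hU.interior_eq]
      ext y
      constructor
      · rintro ⟨h1, -, h2⟩
        rwa [mem_preimage, c.right_inv h1] at h2
      · intro hy
        have h1 := hrc hy
        exact ⟨h1, c.map_target h1, by rwa [mem_preimage, c.right_inv h1]⟩
    rw [this]
    exact convex_ball _ _

/-- Knots close to `K` can be deformed, through knots, from `K` to loops that agree with them on the
set `A`. The deformed loops `L J` are required to stay close to `K`, so that the deformation can be
continued. -/
def DeformsOnto {S : OrientedSurface} (K : Knot S) (A : Set Circle) : Prop :=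
  ∃ L : Knot S → Knot S, C1Tendsto (𝓝 K) (fun J ↦ (L J).toFun) K.toFun ∧
    ∀ᶠ J in 𝓝 K, (∀ z ∈ A, (L J).toFun z = J.toFun z) ∧ Joined K (L J)

theorem DeformsOnto.empty {S : OrientedSurface} (K : Knot S) : DeformsOnto K ∅ := by
  refine ⟨fun _ ↦ K, fun t ↦ ?_, Eventually.of_forall fun J ↦ ⟨by simp, .refl K⟩⟩
  obtain ⟨e, he, h⟩ := c1Tendsto_nhds K t
  exact ⟨e, he, h.comp (φ := fun _ : Knot S ↦ K) (m := 𝓝 K) tendsto_const_nhds⟩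

/-- Interpolation, cut off near `z₀`, extends the set of agreement by a neighbourhood of `z₀`. -/
theorem exists_nhds_deformsOnto {S : OrientedSurface} (K : Knot S) (z₀ : Circle) :
    ∃ B ∈ 𝓝 z₀, ∀ A, DeformsOnto K A → DeformsOnto K (A ∪ B) := by
  obtain ⟨e, he, hz₀, hconv⟩ := exists_chart_convex_target (K.toFun z₀).1
  have hV : {z | (K.toFun z).1 ∈ e.source} ∈ 𝓝 z₀ :=
    (e.open_source.preimage (continuous_fst.comp K.contMDiff.continuous)).mem_nhds hz₀
  obtain ⟨ρ, -, hρV⟩ := (SmoothBumpFunction.nhds_basis_tsupport (I := 𝓡 1) z₀).mem_iff.1 hV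
  refine ⟨{z | ρ z = 1}, ρ.eventuallyEq_one, ?_⟩
  rintro A ⟨L, hL, hLA⟩
  have hρ : ∀ z, ρ z ∈ Icc (0 : ℝ) 1 := fun z ↦ ρ.mem_Icc
  have hρs : ContMDiff (𝓡 1) 𝓘(ℝ, ℝ) ∞ ρ := ρ.contMDiff
  have hLs : ∀ᶠ J in 𝓝 K, IsSmoothLoop (L J).toFun := Eventually.of_forall fun J ↦ (L J).contMDiff
  have hMs : ∀ᶠ J in 𝓝 K, IsSmoothLoop J.toFun := Eventually.of_forall fun J ↦ J.contMDiff
  have hZ : IsCompact (tsupport ρ) := (isClosed_tsupport _).isCompact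
  have hgood : ∀ᶠ J in 𝓝 K, ∀ z ∈ tsupport ρ,
      ((L J).toFun z).1 ∈ e.source ∧ (J.toFun z).1 ∈ e.source := by
    filter_upwards [hL.eventually_forall_mem hZ e.open_source fun z hz ↦ hρV hz,
      (c1Tendsto_nhds K).eventually_forall_mem hZ e.open_source fun z hz ↦ hρV hz]
      with J h1 h2 z hz
    exact ⟨h1 z hz, h2 z hz⟩
  have hsm : ∀ᶠ J in 𝓝 K, ContMDiff (𝓘(ℝ, ℝ).prod (𝓡 1)) ((𝓡 2).prod 𝓘(ℝ, ℝ)) ∞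
      (fun p : ℝ × Circle ↦ interpolate e ρ (L J).toFun J.toFun p.1 p.2) := by
    filter_upwards [hgood] with J hJ
    exact contMDiff_interpolate he hconv hρ hρs (L J).contMDiff J.contMDiff hJ
  have hC := C1Tendsto.interpolate he hconv hρ hρs K.contMDiff (fun z hz ↦ hρV hz) hL hLs
    (c1Tendsto_nhds K) hMs
  have hknot : ∀ᶠ J in 𝓝 K, ∀ s : ℝ,
      ∃ J' : Knot S, J'.toFun = interpolate e ρ (L J).toFun J.toFun s := by
    have h1 := hC.eventually_knot K <| (hsm.prod_inl ⊤).mono fun p hp ↦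
      ContMDiff.comp (f := fun z : Circle ↦ (p.2, z)) hp (contMDiff_const.prodMk contMDiff_id)
    filter_upwards [h1.curry] with J hJ
    exact eventually_top.1 hJ
  have hch : ∀ J : Knot S, ∃ J₁ : Knot S,
      (∃ J' : Knot S, J'.toFun = interpolate e ρ (L J).toFun J.toFun 1) →
        J₁.toFun = interpolate e ρ (L J).toFun J.toFun 1 := fun J ↦ by
    by_cases h : ∃ J' : Knot S, J'.toFun = interpolate e ρ (L J).toFun J.toFun 1
    · exact ⟨h.choose, fun _ ↦ h.choose_spec⟩
    · exact ⟨J, fun h' ↦ absurd h' h⟩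
  -- the new loop is the interpolation at time `1`, where this is a knot
  choose L' hL' using hch
  refine ⟨L', fun t ↦ ?_, ?_⟩
  · obtain ⟨e', he', h⟩ := hC t
    have hφ : Tendsto (fun J : Knot S ↦ (J, (1 : ℝ))) (𝓝 K) (𝓝 K ×ˢ ⊤) :=
      tendsto_id.prodMk tendsto_top
    have h1 := h.comp hφ
    have h2 : ∀ᶠ p in 𝓝 K ×ˢ 𝓝 t, (L' (p : Knot S × ℝ).1).toFun =
        interpolate e ρ (L p.1).toFun p.1.toFun 1 :=
      (hknot.mono fun J hJ ↦ hL' J (hJ 1)).prod_inl _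
    refine ⟨e', he', h1.mem_source, ?_, h1.tendsto.congr' ?_, h1.tendsto_deriv.congr' ?_⟩
    · filter_upwards [h1.eventually_mem, h2] with p hp hp'
      rwa [hp']
    · filter_upwards [h2] with p hp
      rw [hp]
    · filter_upwards [h2] with p hp
      rw [hp]
  · filter_upwards [hLA, hgood, hsm, hknot] with J ⟨h1, h2⟩ h3 h4 h5
    have h6 := hL' J (h5 1)
    refine ⟨?_, h2.trans ?_⟩
    · rintro z (hz | hz)
      · rw [h6]
        exact interpolate_of_eq _ (fun z hz ↦ (h3 z hz).1) (h1 z hz)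
      · have hz' : z ∈ tsupport ρ := subset_tsupport _ (by
          rw [Function.mem_support, show ρ z = 1 from hz]; exact one_ne_zero)
        rw [h6]
        exact interpolate_one hz (h3 z hz').1 (h3 z hz').2
    · choose γ hγ using h5
      have hc := continuous_knot_family h4 γ fun s z ↦ congrFun (hγ s) z
      refine ⟨⟨⟨fun s : unitInterval ↦ γ s, hc.comp continuous_subtype_val⟩, ?_, ?_⟩⟩
      · refine Knot.ext fun z ↦ ?_
        change (γ 0).toFun z = _
        rw [hγ, interpolate_zero fun z hz ↦ (h3 z hz).1]
      · refine Knot.ext fun z ↦ ?_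
        change (γ 1).toFun z = _
        rw [hγ, h6]

/-- All knots in a neighbourhood of `K` are joined to `K` by a path of knots. The finitely many
deformations along a cover of the circle by arcs are composed by induction. -/
theorem Knot.eventually_joined {S : OrientedSurface} (K : Knot S) : ∀ᶠ J in 𝓝 K, Joined K J := by
  have h : ∀ A, DeformsOnto K A → DeformsOnto K (A ∪ univ) := by
    refine isCompact_univ.induction_on
      (p := fun B ↦ ∀ A, DeformsOnto K A → DeformsOnto K (A ∪ B)) ?_ ?_ ?_ ?_
    · intro A hA
      rwa [union_empty]
    · rintro B B' hB h A hA
      obtain ⟨L, h1, h2⟩ := h A hA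
      exact ⟨L, h1, h2.mono fun J hJ ↦
        ⟨fun z hz ↦ hJ.1 z (union_subset_union_right A hB hz), hJ.2⟩⟩
    · intro B B' h h' A hA
      rw [← union_assoc]
      exact h' _ (h A hA)
    · intro z _
      obtain ⟨B, hB, h⟩ := exists_nhds_deformsOnto K z
      exact ⟨B, mem_nhdsWithin_of_mem_nhds hB, h⟩
  obtain ⟨L, -, h2⟩ := h ∅ (.empty K)
  filter_upwards [h2] with J hJ
  have : L J = J := Knot.ext fun z ↦ hJ.1 z (by simp)
  exact this ▸ hJ.2

/-! ### Arrows of the site are open embeddings -/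

/-- The charts of the domain of an embedding are charts of its codomain, so that the subbasic open
sets correspond to each other. -/
theorem Knot.isInducing_push {S T : OrientedSurface} {ψ : S → T} (hψ : IsOrientedEmbedding ψ) :
    IsInducing (Knot.push ψ hψ) := by
  refine ⟨le_antisymm (continuous_iff_le_induced.1 (Knot.continuous_push hψ)) ?_⟩
  refine le_generateFrom ?_
  rintro _ ⟨e, he, C, hC, W, hW, rfl⟩
  rcases isEmpty_or_nonempty S with hS | hS
  · have : IsEmpty (Knot S) := ⟨fun K ↦ hS.false (K.toFun 1).1⟩
    rw [Set.eq_empty_of_isEmpty {K : Knot S | _}]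
    exact @isOpen_empty _ (_)
  let Φ := hψ.isOpenEmbedding.toOpenPartialHomeomorph ψ
  have hΦ : ∀ x, Φ.symm (ψ x) = x := fun x ↦ Φ.left_inv (by simp [Φ])
  refine ⟨_, isOpen_generateFrom_of_mem ⟨Φ.symm.trans e, ?_, C, hC, W, hW, rfl⟩, ?_⟩
  · refine OpenPartialHomeomorph.mem_maximalAtlas_of_contMDiffOn _ ?_ ?_
    · intro y hy
      rw [OpenPartialHomeomorph.trans_source] at hy
      obtain ⟨x, rfl⟩ : ∃ x, ψ x = y := by simpa [Φ] using hy.1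
      have h1 : ContMDiffAt (𝓡 2) (𝓡 2) ∞ e (Φ.symm (ψ x)) :=
        contMDiffAt_of_mem_maximalAtlas he hy.2
      exact (h1.comp (ψ x) (hψ.contMDiffAt_symm Φ rfl x (by simp [Φ]))).contMDiffWithinAt
    · intro y hy
      rw [OpenPartialHomeomorph.trans_target] at hy
      exact (hψ.contMDiff.contMDiffAt.comp y
        (contMDiffAt_symm_of_mem_maximalAtlas he hy.1)).contMDiffWithinAt
  · have hjet : ∀ (K : Knot S) (t : ℝ), (Knot.push ψ hψ K).jet (Φ.symm.trans e) t = K.jet e t := by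
      intro K t
      unfold Knot.jet Knot.push
      simp [hΦ]
    ext K
    simp only [mem_preimage, mem_ofPred_eq, hjet]
    simp [Knot.push, hΦ]
    simp [Φ]

theorem Knot.push_injective {S T : OrientedSurface} {ψ : S → T} (hψ : IsOrientedEmbedding ψ) :
    Function.Injective (Knot.push ψ hψ) := fun K L h ↦ Knot.ext fun z ↦ by
  have h1 : Prod.map ψ id (K.toFun z) = Prod.map ψ id (L.toFun z) :=
    congrArg (fun J : Knot T ↦ J.toFun z) h
  exact hψ.isEmbedding.injective.prodMap Function.injective_id h1

/-- A knot that lies over the image of an embedding comes from the domain of the embedding. -/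
theorem Knot.mem_range_push {S T : OrientedSurface} {ψ : S → T} (hψ : IsOrientedEmbedding ψ)
    {K : Knot T} (hK : ∀ z, (K.toFun z).1 ∈ range ψ) : K ∈ range (Knot.push ψ hψ) := by
  let O : Opens T := ⟨range ψ, hψ.isOpenEmbedding.isOpen_range⟩
  have hO : ∀ x : T.restrict O, ∃ y, ψ y = T.incl O x := fun x ↦ x.2
  choose θ hθ using hO
  have hθe : IsOrientedEmbedding θ :=
    hψ.of_comp_eq (T.isOrientedEmbedding_incl O) (funext hθ)
  exact ⟨Knot.push θ hθe (K.restrict O hK), Knot.ext fun z ↦ Prod.ext (hθ _) rfl⟩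

theorem Knot.isOpenEmbedding_push {S T : OrientedSurface} {ψ : S → T}
    (hψ : IsOrientedEmbedding ψ) : IsOpenEmbedding (Knot.push ψ hψ) := by
  refine ⟨⟨isInducing_push hψ, push_injective hψ⟩, isOpen_iff_mem_nhds.2 ?_⟩
  rintro _ ⟨K, rfl⟩
  filter_upwards [(c1Tendsto_nhds (Knot.push ψ hψ K)).eventually_forall_mem isCompact_univ
    hψ.isOpenEmbedding.isOpen_range fun z _ ↦ ⟨_, rfl⟩] with J hJ
  exact mem_range_push hψ fun z ↦ hJ z trivial

theorem VK.Hom.isOpenEmbedding {U V : VK} (f : VK.Hom U V) : IsOpenEmbedding f.toFun := by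
  obtain ⟨ψ, hψ, h⟩ := f.exists_embedding
  refine .of_comp _ V.nbhd.2.isOpenEmbedding_subtypeVal ?_
  have h1 := (Knot.isOpenEmbedding_push hψ).comp U.nbhd.2.isOpenEmbedding_subtypeVal
  exact (funext h : Subtype.val ∘ f.toFun = Knot.push ψ hψ ∘ Subtype.val) ▸ h1

/-! ### Variable-space isotopies -/

theorem variableSpaceKnot_toFun {U V : VK} (f : U ⟶ V) (K : U.nbhd) :
    variableSpaceKnot V (VK.Hom.toFun f K) = variableSpaceKnot U K :=
  Quotient.sound (Zigzag.of_inv (CategoryOfElements.homMk (F := forgetVK)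
    (forgetVK.elementsMk U K) (forgetVK.elementsMk V (VK.Hom.toFun f K)) f rfl))

/-- A property of knots that is transported forwards and backwards along the arrows of the site
depends only on the variable-space knot. -/
theorem variableSpaceKnot_induction {P : ∀ U : VK, U.nbhd → Prop}
    (h₁ : ∀ {U V : VK} (f : VK.Hom U V) (K : U.nbhd), P U K → P V (f.toFun K))
    (h₂ : ∀ {U V : VK} (f : VK.Hom U V) (K : U.nbhd), P V (f.toFun K) → P U K)
    {U V : VK} {K : U.nbhd} {L : V.nbhd} (h : variableSpaceKnot U K = variableSpaceKnot V L)
    (hK : P U K) : P V L := by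
  have h3 : Zigzag (forgetVK.elementsMk U K) (forgetVK.elementsMk V L) := Quotient.exact h
  have h4 : ∀ x y : forgetVK.Elements, Zag x y → P x.1 x.2 → P y.1 y.2 := by
    rintro ⟨A, a⟩ ⟨B, b⟩ (⟨⟨f, hf⟩⟩ | ⟨⟨f, hf⟩⟩) ha
    · have hf' : VK.Hom.toFun f a = b := hf
      exact hf' ▸ h₁ f a ha
    · have hf' : VK.Hom.toFun f b = a := hf
      exact h₂ f b (hf' ▸ ha)
  have h5 : ∀ y : forgetVK.Elements, Zigzag (forgetVK.elementsMk U K) y → P y.1 y.2 := by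
    intro y hy
    induction hy with
    | refl => exact hK
    | tail _ hz ih => exact h4 _ _ hz ih
  exact h5 _ h3

theorem exists_variableSpaceKnot_eq (v : VariableSpaceKnot) :
    ∃ (U : VK) (K : U.nbhd), variableSpaceKnot U K = v := by
  obtain ⟨⟨U, K⟩, rfl⟩ := Quotient.exists_rep v
  exact ⟨U, K, rfl⟩

/-- The path `σ` of variable-space knots lifts, near `t`, to a continuous path of knots in `U`
through `K`. -/
def LiftsAt (σ : unitInterval → VariableSpaceKnot) (t : unitInterval) (U : VK) (K : U.nbhd) :
    Prop :=
  ∃ (N : Set unitInterval) (γ : unitInterval → U.nbhd), IsOpen N ∧ t ∈ N ∧ ContinuousOn γ N ∧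
    γ t = K ∧ ∀ s ∈ N, variableSpaceKnot U (γ s) = σ s

theorem LiftsAt.map {σ : unitInterval → VariableSpaceKnot} {t : unitInterval} {U V : VK}
    (f : VK.Hom U V) {K : U.nbhd} (h : LiftsAt σ t U K) : LiftsAt σ t V (f.toFun K) := by
  obtain ⟨N, γ, hN, ht, hγ, rfl, hσ⟩ := h
  exact ⟨N, f.toFun ∘ γ, hN, ht, f.isOpenEmbedding.continuous.comp_continuousOn hγ, rfl,
    fun s hs ↦ (variableSpaceKnot_toFun f _).trans (hσ s hs)⟩

theorem LiftsAt.of_map {σ : unitInterval → VariableSpaceKnot} {t : unitInterval} {U V : VK}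
    (f : VK.Hom U V) {K : U.nbhd} (h : LiftsAt σ t V (f.toFun K)) : LiftsAt σ t U K := by
  obtain ⟨N, γ, hN, ht, hγ, hK, hσ⟩ := h
  have : Nonempty U.nbhd := ⟨K⟩
  let Φ := f.isOpenEmbedding.toOpenPartialHomeomorph f.toFun
  have htarget : Φ.target = range f.toFun := by simp [Φ]
  have hright : ∀ J ∈ range f.toFun, f.toFun (Φ.symm J) = J := fun J hJ ↦
    Φ.right_inv (htarget ▸ hJ)
  refine ⟨N ∩ γ ⁻¹' range f.toFun, Φ.symm ∘ γ,
    hγ.isOpen_inter_preimage hN f.isOpenEmbedding.isOpen_range, ⟨ht, K, hK.symm⟩, ?_, ?_, ?_⟩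
  · exact Φ.continuousOn_symm.comp (hγ.mono inter_subset_left) fun s hs ↦ htarget ▸ hs.2
  · exact f.isOpenEmbedding.injective ((hright _ ⟨K, hK.symm⟩).trans hK)
  · intro s hs
    rw [← hσ s hs.1]
    exact (variableSpaceKnot_toFun f _).symm.trans (congrArg _ (hright _ hs.2))

/-- A continuous path in an object of the site gives a variable-space isotopy. -/
def isotopyOfPath (U : VK) {K L : U.nbhd} (p : Path K L) :
    VariableSpaceIsotopy (variableSpaceKnot U K) (variableSpaceKnot U L) where
  toFun s := variableSpaceKnot U (p s)
  locally_continuous V t J hJ := by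
    obtain ⟨N, γ, hN, ht, hγ, hJ, hσ⟩ : LiftsAt (fun s ↦ variableSpaceKnot U (p s)) t V J :=
      variableSpaceKnot_induction (P := LiftsAt _ t) (fun f _ h ↦ h.map f) (fun f _ h ↦ h.of_map f)
        hJ.symm ⟨univ, p, isOpen_univ, trivial, p.continuous.continuousOn, rfl, fun _ _ ↦ rfl⟩
    exact ⟨N, hN.mem_nhds ht, N.domRestrict γ, hγ.domRestrict, hJ, fun s ↦ hσ s s.2⟩
  map_zero := by rw [p.source]
  map_one := by rw [p.target]

/-- A function of variable-space knots is continuous, for the discrete topology on the values, if it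
is locally constant on each object of the site. -/
def IsLocallyConstantOnVK {G : Type*} (ν : VariableSpaceKnot → G) : Prop :=
  ∀ U : VK, IsLocallyConstant fun K : U.nbhd ↦ ν (variableSpaceKnot U K)

theorem IsLocallyConstantOnVK.eq_of_isotopy {G : Type*} {ν : VariableSpaceKnot → G}
    (hν : IsLocallyConstantOnVK ν) {V₀ V₁ : VariableSpaceKnot} (σ : VariableSpaceIsotopy V₀ V₁) :
    ν V₀ = ν V₁ := by
  have h : IsLocallyConstant (ν ∘ σ.toFun) := by
    refine (IsLocallyConstant.iff_eventually_eq _).2 fun t ↦ ?_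
    obtain ⟨U, K, hK⟩ := exists_variableSpaceKnot_eq (σ.toFun t)
    obtain ⟨N, hN, γ, hγ, hγt, hσ⟩ := σ.locally_continuous U t K hK
    have h1 := ((IsLocallyConstant.iff_eventually_eq _).1
      ((hν U).comp_continuous hγ)) ⟨t, mem_of_mem_nhds hN⟩
    rw [← map_nhds_subtype_coe_eq_nhds (mem_of_mem_nhds hN) hN, eventually_map]
    filter_upwards [h1] with s hs
    simpa [hσ] using hs
  have h1 := h.apply_eq_of_isPreconnected isPreconnected_univ (mem_univ 0) (mem_univ 1)
  simpa [σ.map_zero, σ.map_one] using h1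

theorem isLocallyConstantOnVK_of_isotopy {G : Type*} {ν : VariableSpaceKnot → G}
    (h : ∀ {V₀ V₁ : VariableSpaceKnot}, VariableSpaceIsotopy V₀ V₁ → ν V₀ = ν V₁) :
    IsLocallyConstantOnVK ν := by
  intro U
  refine (IsLocallyConstant.iff_eventually_eq _).2 fun K ↦ ?_
  -- the path may leave `U`, so it is taken in the object of all knots
  let T : VK := ⟨U.surface, ⊤⟩
  let i : VK.Hom U T := ⟨fun K ↦ ⟨K.1, trivial⟩, _, .id _, fun _ ↦ rfl⟩
  have h1 : ∀ᶠ J in 𝓝 (i.toFun K), Joined (i.toFun K) J := by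
    have h2 := K.1.eventually_joined
    have h3 : Tendsto (Subtype.val : T.nbhd → Knot U.surface) (𝓝 (i.toFun K)) (𝓝 K.1) :=
      continuous_subtype_val.tendsto _
    filter_upwards [h3.eventually h2] with J ⟨p⟩
    exact ⟨⟨⟨fun s ↦ ⟨p s, trivial⟩, p.continuous.subtype_mk _⟩, Subtype.ext p.source,
      Subtype.ext p.target⟩⟩
  filter_upwards [(i.isOpenEmbedding.continuous.tendsto K).eventually h1] with J ⟨p⟩
  have h2 := h (isotopyOfPath T p)
  rw [variableSpaceKnot_toFun i, variableSpaceKnot_toFun i] at h2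
  exact h2.symm

/-! ### Supports of sheaves on the virtual knot site -/


theorem nonempty_of_mem_topology {C : Type*} [Category* C] {J : GrothendieckTopology C}
    (F : Sheaf J (Type*)) (hF : ∀ U, Subsingleton (F.obj.obj U)) {U : C} {R : Sieve U}
    (hR : R ∈ J U) (h : ∀ (V : C) (f : V ⟶ U), R f → Nonempty (F.obj.obj (op V))) :
    Nonempty (F.obj.obj (op U)) := by
  obtain ⟨t, -, -⟩ := (isSheaf_iff_isSheaf_of_type J F.obj).1 F.property R hR
    (fun V f hf ↦ (h V f hf).some) fun _ _ _ _ _ _ _ _ _ _ ↦ (hF _).elim _ _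
  exact ⟨t⟩

/-- The object of the site given by an open subset of an object. -/
def VK.restrict (U : VK) (A : Set U.nbhd) (hA : IsOpen A) : VK :=
  ⟨U.surface, ⟨Subtype.val '' A, U.nbhd.2.isOpenMap_subtype_val _ hA⟩⟩

/-- The inclusion of an open subset of an object. -/
def VK.restrictIncl (U : VK) (A : Set U.nbhd) (hA : IsOpen A) : U.restrict A hA ⟶ U :=
  VK.Hom.mk (fun K ↦ ⟨K.1, by obtain ⟨L, -, hL⟩ := K.2; exact hL ▸ L.2⟩) ⟨_, .id _, fun _ ↦ rfl⟩

/-- An arrow with values in an open subset, as an arrow to this open subset. -/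
def VK.restrictLift {U W : VK} (A : Set U.nbhd) (hA : IsOpen A) (f : VK.Hom W U)
    (hf : ∀ L, f.toFun L ∈ A) : W ⟶ U.restrict A hA :=
  VK.Hom.mk (fun L ↦ ⟨(f.toFun L).1, f.toFun L, hf L, rfl⟩) f.exists_embedding

theorem VK.restrictIncl_mem {U : VK} {A : Set U.nbhd} {hA : IsOpen A} (K : (U.restrict A hA).nbhd) :
    VK.Hom.toFun (U.restrictIncl A hA) K ∈ A := by
  obtain ⟨_, L, hL, rfl⟩ := K
  exact hL

theorem VK.exists_restrictIncl_eq {U : VK} {A : Set U.nbhd} (hA : IsOpen A) {K : U.nbhd}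
    (hK : K ∈ A) : ∃ L, VK.Hom.toFun (U.restrictIncl A hA) L = K :=
  ⟨⟨K.1, K, hK, rfl⟩, rfl⟩

/-- The variable-space knots which are represented in an object over which the sheaf `F` has a
section. -/
def Supp (F : ShVK.{w}) (v : VariableSpaceKnot) : Prop :=
  ∃ (U : VK) (K : U.nbhd), variableSpaceKnot U K = v ∧ Nonempty (F.obj.obj (op U))

/-- The sieve of those arrows over whose domain `F` has a section. -/
def sectionSieve (F : ShVK.{w}) (U : VK) : Sieve U where
  arrows V _ := Nonempty (F.obj.obj (op V))
  downward_closed := fun ⟨x⟩ g ↦ ⟨F.obj.map g.op x⟩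

/-- If `F` is supported at the class of a knot, then it has a section on a neighbourhood of this
knot, whichever representative is considered: fibre products transport neighbourhoods along
zigzags. -/
theorem supp_iff {F : ShVK.{w}} {U : VK} {K : U.nbhd} :
    Supp F (variableSpaceKnot U K) ↔
      ∃ (V : VK) (f : V ⟶ U) (L : V.nbhd), VK.Hom.toFun f L = K ∧ Nonempty (F.obj.obj (op V)) := by
  constructor
  · rintro ⟨U', K', h, hF⟩
    refine variableSpaceKnot_induction (P := fun U K ↦ ∃ (V : VK) (f : V ⟶ U) (L : V.nbhd),
      VK.Hom.toFun f L = K ∧ Nonempty (F.obj.obj (op V))) ?_ ?_ h ⟨U', 𝟙 U', K', rfl, hF⟩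
    · rintro A B f K ⟨V, g, L, rfl, hV⟩
      exact ⟨V, g ≫ f, L, rfl, hV⟩
    · rintro A B f K ⟨V, g, L, hL, hV⟩
      -- over the image `B'` of `g`, the arrow from `V` alone is covering
      have hr := (VK.Hom.isOpenEmbedding g).isOpen_range
      let B' := B.restrict _ hr
      have hS : sectionSieve F B' ∈ topologyVK B' := by
        intro J
        obtain ⟨M, hM⟩ := VK.restrictIncl_mem J
        exact ⟨V, VK.restrictLift _ hr g mem_range_self, M, hV,
          Subtype.ext (congrArg Subtype.val hM :)⟩
      have hp : IsOpen (f.toFun ⁻¹' range (VK.Hom.toFun g)) :=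
        hr.preimage f.isOpenEmbedding.continuous
      let A' := A.restrict _ hp
      obtain ⟨K', hK'⟩ := VK.exists_restrictIncl_eq hp (K := K) ⟨L, hL⟩
      let f' : A' ⟶ B' := VK.restrictLift _ hr (A.restrictIncl _ hp ≫ f : VK.Hom A' B)
        fun J ↦ VK.restrictIncl_mem J
      obtain ⟨X, h, M, hX, hM⟩ := topologyVK.pullback_stable f' hS K'
      exact ⟨X, h ≫ A.restrictIncl _ hp, M, (congrArg _ hM).trans hK', hX⟩
  · rintro ⟨V, f, L, rfl, hV⟩
    exact ⟨V, L, (variableSpaceKnot_toFun f L).symm, hV⟩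

theorem nonempty_iff_forall_supp {F : ShVK.{w}} (hF : ∀ U, Subsingleton (F.obj.obj U)) {U : VK} :
    Nonempty (F.obj.obj (op U)) ↔ ∀ K, Supp F (variableSpaceKnot U K) := by
  refine ⟨fun h K ↦ ⟨U, K, rfl, h⟩, fun h ↦ ?_⟩
  refine nonempty_of_mem_topology F hF (R := sectionSieve F U) (fun K ↦ ?_) fun _ _ h ↦ h
  obtain ⟨V, f, L, hL, hV⟩ := supp_iff.1 (h K)
  exact ⟨V, f, L, hV, hL⟩

theorem isOpen_setOf_supp (F : ShVK.{w}) (U : VK) :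
    IsOpen {K : U.nbhd | Supp F (variableSpaceKnot U K)} := by
  refine isOpen_iff_mem_nhds.2 fun K hK ↦ ?_
  obtain ⟨V, f, L, rfl, hV⟩ := supp_iff.1 hK
  filter_upwards [(VK.Hom.isOpenEmbedding f).isOpen_range.mem_nhds ⟨L, rfl⟩]
  rintro _ ⟨M, rfl⟩
  exact supp_iff.2 ⟨V, f, M, rfl, hV⟩

/-- The subterminal sheaf that has a section over `U` if and only if all knots in `U` satisfy the
predicate `Q` of variable-space knots. -/
def predicateSheaf (Q : VariableSpaceKnot → Prop) : ShVK.{w} where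
  obj :=
    { obj := fun U ↦ ULift (PLift (∀ K : U.unop.nbhd, Q (variableSpaceKnot U.unop K)))
      map := fun f ↦ ↾ fun x ↦ ⟨⟨fun K ↦ variableSpaceKnot_toFun f.unop K ▸ x.down.down _⟩⟩ }
  property := by
    refine (isSheaf_iff_isSheaf_of_type _ _).2 fun U R hR x _ ↦ ?_
    refine ⟨⟨⟨fun K ↦ ?_⟩⟩, fun _ _ _ ↦ Subsingleton.elim _ _, fun _ _ ↦ Subsingleton.elim _ _⟩
    obtain ⟨V, f, L, hf, rfl⟩ := hR K
    exact (variableSpaceKnot_toFun f L).symm ▸ (x f hf).down.down L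

instance (Q : VariableSpaceKnot → Prop) (U : VKᵒᵖ) :
    Subsingleton ((predicateSheaf.{w} Q).obj.obj U) :=
  inferInstanceAs (Subsingleton (ULift (PLift _)))

/-- A morphism to a sheaf with at most one section over each object. -/
noncomputable def homOfSubsingleton {C : Type*} [Category* C] {J : GrothendieckTopology C}
    {F X : Sheaf J (Type w)}
    (hF : ∀ U, Subsingleton (F.obj.obj U))
    (h : ∀ U, Nonempty (X.obj.obj U) → Nonempty (F.obj.obj U)) : X ⟶ F where
  hom :=
    { app := fun U ↦ ↾ fun x ↦ (h U ⟨x⟩).some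
      naturality := fun _ _ _ ↦ by
        ext
        exact (hF _).elim _ _ }

theorem hom_subsingleton {C : Type*} [Category* C] {J : GrothendieckTopology C}
    {F : Sheaf J (Type w)} (hF : ∀ U, Subsingleton (F.obj.obj U)) (X : Sheaf J (Type w)) :
    Subsingleton (X ⟶ F) := by
  refine ⟨fun a b ↦ ?_⟩
  ext U x
  exact (hF _).elim _ _

/-! ### Geometric morphisms to sheaves on a space -/

section

variable {G : Type w} [TopologicalSpace G]

instance subsingleton_representable (H : Opens G) (V : (Opens G)ᵒᵖ) :
    Subsingleton ((representable H).obj.obj V) :=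
  inferInstanceAs (Subsingleton (ULift (V.unop ⟶ H)))

theorem nonempty_representable_iff {H : Opens G} {V : (Opens G)ᵒᵖ} :
    Nonempty ((representable H).obj.obj V) ↔ V.unop ≤ H :=
  ⟨fun ⟨x⟩ ↦ (show ULift (V.unop ⟶ H) from x).down.le,
    fun h ↦ ⟨(⟨homOfLE h⟩ : ULift (V.unop ⟶ H))⟩⟩

/-- The functor of sections over `U` of the inverse image of a sheaf. -/
abbrev GeometricMorphism.sections (f : GeometricMorphism ShVK.{w} (Sh.{w} G)) (U : VKᵒᵖ) :
    Sh.{w} G ⥤ Type (max 1 w) :=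
  f.inverseImage ⋙ sheafToPresheaf _ _ ⋙ (evaluation _ _).obj U

theorem GeometricMorphism.preservesFiniteLimits_sections
    (f : GeometricMorphism ShVK.{w} (Sh.{w} G)) (U : VKᵒᵖ) :
    Limits.PreservesFiniteLimits (f.sections U) := by
  have := f.preservesFiniteLimits
  infer_instance

/-- The sheaf represented by the whole space is terminal. -/
noncomputable def isTerminalRepresentableTop : Limits.IsTerminal (representable (⊤ : Opens G)) :=
  Limits.IsTerminal.ofUniqueHom
    (fun _ ↦ homOfSubsingleton (subsingleton_representable ⊤)
      fun _ _ ↦ nonempty_representable_iff.2 le_top)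
    fun X _ ↦ (hom_subsingleton (subsingleton_representable ⊤) X).elim _ _

theorem GeometricMorphism.nonempty_top (f : GeometricMorphism ShVK.{w} (Sh.{w} G)) (U : VKᵒᵖ) :
    Nonempty ((f.inverseImage.obj (representable ⊤)).obj.obj U) := by
  have := f.preservesFiniteLimits_sections U
  have h := Limits.Types.isTerminalEquivUnique _
    (Limits.IsTerminal.isTerminalObj (f.sections U) _ isTerminalRepresentableTop)
  exact ⟨h.default⟩

theorem GeometricMorphism.subsingleton_inverseImage (f : GeometricMorphism ShVK.{w} (Sh.{w} G))
    (H : Opens G) (U : VKᵒᵖ) :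
    Subsingleton ((f.inverseImage.obj (representable H)).obj.obj U) := by
  have := f.preservesFiniteLimits_sections U
  have h := Limits.Types.isTerminalEquivUnique _
    (Limits.IsTerminal.isTerminalObj (f.sections U) _ isTerminalRepresentableTop)
  have hs : Subsingleton ((f.sections U).obj (representable ⊤)) := ⟨fun a b ↦
    (h.uniq a).trans (h.uniq b).symm⟩
  let i : representable H ⟶ representable (⊤ : Opens G) := isTerminalRepresentableTop.from _
  have hi : Mono i := ⟨fun _ _ _ ↦ (hom_subsingleton (subsingleton_representable H) _).elim _ _⟩
  exact ((mono_iff_injective ((f.sections U).map i)).1 inferInstance).subsingleton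

theorem GeometricMorphism.nonempty_inf (f : GeometricMorphism ShVK.{w} (Sh.{w} G))
    {H H' : Opens G} {U : VKᵒᵖ}
    (h : Nonempty ((f.inverseImage.obj (representable H)).obj.obj U))
    (h' : Nonempty ((f.inverseImage.obj (representable H')).obj.obj U)) :
    Nonempty ((f.inverseImage.obj (representable (H ⊓ H'))).obj.obj U) := by
  have := f.preservesFiniteLimits_sections U
  have hs := subsingleton_representable H
  have hs' := subsingleton_representable H'
  have hsi := subsingleton_representable (H ⊓ H')
  let a : representable (H ⊓ H') ⟶ representable H := homOfSubsingleton hs fun V h ↦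
    nonempty_representable_iff.2 ((nonempty_representable_iff.1 h).trans inf_le_left)
  let b : representable (H ⊓ H') ⟶ representable H' := homOfSubsingleton hs' fun V h ↦
    nonempty_representable_iff.2 ((nonempty_representable_iff.1 h).trans inf_le_right)
  have hl : Limits.IsLimit (Limits.BinaryFan.mk a b) := Limits.BinaryFan.IsLimit.mk _
    (fun u v ↦ homOfSubsingleton hsi fun V ⟨x⟩ ↦ nonempty_representable_iff.2
      (le_inf (nonempty_representable_iff.1 ⟨u.hom.app V x⟩)
        (nonempty_representable_iff.1 ⟨v.hom.app V x⟩)))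
    (fun _ _ ↦ (hom_subsingleton hs _).elim _ _) (fun _ _ ↦ (hom_subsingleton hs' _).elim _ _)
    (fun _ _ _ _ _ ↦ (hom_subsingleton hsi _).elim _ _)
  have hl' := Limits.mapIsLimitOfPreservesOfIsLimit (f.sections U) a b hl
  obtain ⟨x⟩ := h
  obtain ⟨y⟩ := h'
  let p : PUnit ⟶ (f.sections U).obj (representable H) := ↾ fun _ ↦ x
  let q : PUnit ⟶ (f.sections U).obj (representable H') := ↾ fun _ ↦ y
  exact ⟨(Limits.BinaryFan.IsLimit.lift' hl' p q).1 PUnit.unit⟩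

/-- The inverse image of the sheaf represented by a union is supported on the union of the supports.
The covering condition is transported through the adjunction: morphisms to a subterminal sheaf on
the knot site form a sheaf on `G`. -/
theorem GeometricMorphism.supp_of_cover (f : GeometricMorphism ShVK.{w} (Sh.{w} G))
    {H : Opens G} {Q : VariableSpaceKnot → Prop}
    (hQ : ∀ x ∈ H, ∃ H' ≤ H, x ∈ H' ∧ ∀ v, Supp (f.inverseImage.obj (representable H')) v → Q v)
    {v : VariableSpaceKnot} (hv : Supp (f.inverseImage.obj (representable H)) v) : Q v := by
  -- `P` has a section over `V` if and only if `Q` holds on the support belonging to `V`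
  let P := f.directImage.obj (predicateSheaf.{w} Q)
  let E (V : Opens G) : (f.inverseImage.obj (representable V) ⟶ predicateSheaf.{w} Q) ≃
      P.obj.obj (op V) :=
    (f.adjunction.homEquiv _ _).trans
      (GrothendieckTopology.uliftYonedaEquiv.{1} (Opens.grothendieckTopology G))
  have hP : ∀ V, Subsingleton (P.obj.obj V) := fun V ↦
    have := hom_subsingleton (F := predicateSheaf.{w} Q) inferInstance
      (f.inverseImage.obj (representable V.unop))
    (E V.unop).symm.subsingleton
  obtain ⟨x⟩ : Nonempty (P.obj.obj (op H)) := by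
    let R : Sieve H := ⟨fun V _ ↦ Nonempty (P.obj.obj (op V)), fun ⟨x⟩ g ↦ ⟨P.obj.map g.op x⟩⟩
    refine nonempty_of_mem_topology P hP (R := R) (fun g hg ↦ ?_) fun _ _ h ↦ h
    obtain ⟨H', hle, hg', hs⟩ := hQ g hg
    refine ⟨H', homOfLE hle, ⟨E H' (homOfSubsingleton inferInstance fun U hU ↦ ?_)⟩, hg'⟩
    exact ⟨⟨⟨fun K ↦ hs _ ⟨U.unop, K, rfl, hU⟩⟩⟩⟩
  obtain ⟨U, K, rfl, ⟨y⟩⟩ := hv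
  exact (((E H).symm x).hom.app (op U) y).down.down K

theorem GeometricMorphism.supp_mono (f : GeometricMorphism ShVK.{w} (Sh.{w} G))
    {H H' : Opens G} (h : H ≤ H') {v : VariableSpaceKnot}
    (hv : Supp (f.inverseImage.obj (representable H)) v) :
    Supp (f.inverseImage.obj (representable H')) v := by
  obtain ⟨U, K, hK, ⟨x⟩⟩ := hv
  exact ⟨U, K, hK, ⟨(f.inverseImage.map ((GrothendieckTopology.uliftYoneda.{1}
    (Opens.grothendieckTopology G)).map (homOfLE h))).hom.app _ x⟩⟩

theorem GeometricMorphism.supp_inf (f : GeometricMorphism ShVK.{w} (Sh.{w} G))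
    {H H' : Opens G} {v : VariableSpaceKnot}
    (hv : Supp (f.inverseImage.obj (representable H)) v)
    (hv' : Supp (f.inverseImage.obj (representable H')) v) :
    Supp (f.inverseImage.obj (representable (H ⊓ H'))) v := by
  obtain ⟨U, K, rfl, ⟨x⟩⟩ := hv
  obtain ⟨V, g, L, rfl, hV⟩ := supp_iff.1 hv'
  exact ⟨V, L, (variableSpaceKnot_toFun g L).symm,
    f.nonempty_inf ⟨(f.inverseImage.obj (representable H)).obj.map g.op x⟩ hV⟩

variable [DiscreteTopology G]

/-- A point of a discrete space, as an open set. -/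
def openSingleton (g : G) : Opens G := ⟨{g}, isOpen_discrete _⟩

/-- A geometric morphism partitions the variable-space knots according to the points of `G`. -/
theorem GeometricMorphism.existsUnique_supp (f : GeometricMorphism ShVK.{w} (Sh.{w} G))
    (v : VariableSpaceKnot) :
    ∃! g : G, Supp (f.inverseImage.obj (representable (openSingleton g))) v := by
  refine existsUnique_of_exists_of_unique ?_ fun g g' hg hg' ↦ ?_
  · obtain ⟨U, K, hK⟩ := exists_variableSpaceKnot_eq v
    refine f.supp_of_cover (H := ⊤) (Q := fun v ↦ ∃ g : G,
      Supp (f.inverseImage.obj (representable (openSingleton g))) v) ?_ ⟨U, K, hK, f.nonempty_top _⟩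
    exact fun g _ ↦ ⟨openSingleton g, le_top, rfl, fun v hv ↦ ⟨g, hv⟩⟩
  · by_contra hne
    -- the intersection of the two points is empty, and the empty set is covered by nothing
    refine f.supp_of_cover (Q := fun _ ↦ False) ?_ (f.supp_inf hg hg')
    rintro x ⟨h, h'⟩
    exact absurd (h.symm.trans h') hne

/-- The function of variable-space knots defined by a geometric morphism. -/
noncomputable def GeometricMorphism.value (f : GeometricMorphism ShVK.{w} (Sh.{w} G))
    (v : VariableSpaceKnot) : G :=
  (f.existsUnique_supp v).choose

theorem GeometricMorphism.supp_value (f : GeometricMorphism ShVK.{w} (Sh.{w} G))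
    (v : VariableSpaceKnot) :
    Supp (f.inverseImage.obj (representable (openSingleton (f.value v)))) v :=
  (f.existsUnique_supp v).choose_spec.1

theorem GeometricMorphism.supp_singleton_iff (f : GeometricMorphism ShVK.{w} (Sh.{w} G))
    {g : G} {v : VariableSpaceKnot} :
    Supp (f.inverseImage.obj (representable (openSingleton g))) v ↔ f.value v = g :=
  ⟨fun h ↦ ((f.existsUnique_supp v).choose_spec.2 g h).symm, fun h ↦ h ▸ f.supp_value v⟩

theorem GeometricMorphism.supp_iff_value_mem (f : GeometricMorphism ShVK.{w} (Sh.{w} G))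
    {H : Opens G} {v : VariableSpaceKnot} :
    Supp (f.inverseImage.obj (representable H)) v ↔ f.value v ∈ H := by
  refine ⟨fun h ↦ ?_, fun h ↦ ?_⟩
  · refine f.supp_of_cover (Q := fun v ↦ f.value v ∈ H) (fun g hg ↦ ?_) h
    refine ⟨openSingleton g, fun x hx ↦ (show x = g from hx) ▸ hg, rfl, fun v hv ↦ ?_⟩
    rwa [f.supp_singleton_iff.1 hv]
  · exact f.supp_mono (fun x hx ↦ (show x = _ from hx) ▸ h) (f.supp_value v)

theorem GeometricMorphism.nonempty_iff_value_mem (f : GeometricMorphism ShVK.{w} (Sh.{w} G))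
    {U : VK} {H : Opens G} :
    Nonempty ((f.inverseImage.obj (representable H)).obj.obj (op U)) ↔
      ∀ K : U.nbhd, f.value (variableSpaceKnot U K) ∈ H := by
  rw [nonempty_iff_forall_supp (f.subsingleton_inverseImage H)]
  simp only [f.supp_iff_value_mem]

theorem GeometricMorphism.isLocallyConstantOnVK_value
    (f : GeometricMorphism ShVK.{w} (Sh.{w} G)) : IsLocallyConstantOnVK f.value := by
  intro U
  refine (IsLocallyConstant.iff_eventually_eq _).2 fun K ↦ ?_
  filter_upwards [(isOpen_setOf_supp _ U).mem_nhds (f.supp_value (variableSpaceKnot U K))] with L hL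
  exact f.supp_singleton_iff.1 hL

end

section

variable {G : Type w} [TopologicalSpace G]

/-! ### A geometric morphism is determined by its values on representable sheaves -/

/-- Sections of the direct image of `X` over `V` are the morphisms to `X` from the inverse image of
the sheaf represented by `V`. -/
def GeometricMorphism.sectionEquiv (f : GeometricMorphism ShVK.{w} (Sh.{w} G)) (X : ShVK.{w})
    (V : Opens G) :
    (f.inverseImage.obj (representable V) ⟶ X) ≃ (f.directImage.obj X).obj.obj (op V) :=
  (f.adjunction.homEquiv _ _).trans
    (GrothendieckTopology.uliftYonedaEquiv.{1} (Opens.grothendieckTopology G))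

theorem GeometricMorphism.map_sectionEquiv (f : GeometricMorphism ShVK.{w} (Sh.{w} G))
    {X : ShVK.{w}} {V W : Opens G} (h : W ⟶ V) (x : f.inverseImage.obj (representable V) ⟶ X) :
    (f.directImage.obj X).obj.map h.op (f.sectionEquiv X V x) =
      f.sectionEquiv X W (f.inverseImage.map ((GrothendieckTopology.uliftYoneda.{1}
        (Opens.grothendieckTopology G)).map h) ≫ x) := by
  rw [sectionEquiv, sectionEquiv, Equiv.trans_apply, Equiv.trans_apply,
    Adjunction.homEquiv_naturality_left]
  exact GrothendieckTopology.uliftYonedaEquiv_naturality _ _ _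

theorem GeometricMorphism.sectionEquiv_comp (f : GeometricMorphism ShVK.{w} (Sh.{w} G))
    {X Y : ShVK.{w}} {V : Opens G} (x : f.inverseImage.obj (representable V) ⟶ X) (φ : X ⟶ Y) :
    (f.directImage.map φ).hom.app (op V) (f.sectionEquiv X V x) = f.sectionEquiv Y V (x ≫ φ) := by
  rw [sectionEquiv, sectionEquiv, Equiv.trans_apply, Equiv.trans_apply,
    Adjunction.homEquiv_naturality_right]
  rfl

/-- Geometric morphisms whose inverse images agree on representable sheaves have isomorphic direct
images. -/
noncomputable def directImageIso {f g : GeometricMorphism ShVK.{w} (Sh.{w} G)}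
    (h : ∀ H U, Nonempty ((f.inverseImage.obj (representable H)).obj.obj U) ↔
      Nonempty ((g.inverseImage.obj (representable H)).obj.obj U)) :
    f.directImage ≅ g.directImage :=
  let a (V : Opens G) :
      g.inverseImage.obj (representable V) ⟶ f.inverseImage.obj (representable V) :=
    homOfSubsingleton (f.subsingleton_inverseImage V) fun U ↦ (h V U).2
  let b (V : Opens G) :
      f.inverseImage.obj (representable V) ⟶ g.inverseImage.obj (representable V) :=
    homOfSubsingleton (g.subsingleton_inverseImage V) fun U ↦ (h V U).1
  let i (V : Opens G) :
      g.inverseImage.obj (representable V) ≅ f.inverseImage.obj (representable V) :=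
    ⟨a V, b V, (hom_subsingleton (g.subsingleton_inverseImage V) _).elim _ _,
      (hom_subsingleton (f.subsingleton_inverseImage V) _).elim _ _⟩
  let E (X : ShVK.{w}) (V : (Opens G)ᵒᵖ) :
      (f.directImage.obj X).obj.obj V ≃ (g.directImage.obj X).obj.obj V :=
    ((f.sectionEquiv X V.unop).symm.trans ((i V.unop).symm.homCongr (Iso.refl X))).trans
      (g.sectionEquiv X V.unop)
  have hE (X : ShVK.{w}) (V : Opens G) (x : f.inverseImage.obj (representable V) ⟶ X) :
      E X (op V) (f.sectionEquiv X V x) = g.sectionEquiv X V (a V ≫ x) := by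
    simp [E, i]
  NatIso.ofComponents
    (fun X ↦ (fullyFaithfulSheafToPresheaf _ _).preimageIso
      (NatIso.ofComponents (fun V ↦ (E X V).toIso) fun {V W} k ↦ by
        ext y
        obtain ⟨x, rfl⟩ := (f.sectionEquiv X V.unop).surjective y
        change E X W ((f.directImage.obj X).obj.map k.unop.op _) =
          (g.directImage.obj X).obj.map k.unop.op (E X V _)
        rw [f.map_sectionEquiv, hE, hE, g.map_sectionEquiv, ← Category.assoc, ← Category.assoc]
        exact congrArg (fun u ↦ g.sectionEquiv X _ (u ≫ x))
          ((hom_subsingleton (f.subsingleton_inverseImage V.unop) _).elim _ _)))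
    fun {X Y} φ ↦ by
      ext V y
      obtain ⟨x, rfl⟩ := (f.sectionEquiv X V.unop).surjective y
      change E Y V ((f.directImage.map φ).hom.app (op V.unop) _) =
        (g.directImage.map φ).hom.app (op V.unop) (E X V _)
      rw [f.sectionEquiv_comp, hE, hE, g.sectionEquiv_comp, Category.assoc]

theorem isIsomorphic_of_nonempty_iff {f g : GeometricMorphism ShVK.{w} (Sh.{w} G)}
    (h : ∀ H U, Nonempty ((f.inverseImage.obj (representable H)).obj.obj U) ↔
      Nonempty ((g.inverseImage.obj (representable H)).obj.obj U)) : IsIsomorphic f g := by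
  let i := (conjugateIsoEquiv f.adjunction g.adjunction).symm (directImageIso h)
  exact ⟨⟨i.inv, i.hom, i.inv_hom_id, i.hom_inv_id⟩⟩

theorem nonempty_iff_of_isIsomorphic {f g : GeometricMorphism ShVK.{w} (Sh.{w} G)}
    (h : IsIsomorphic f g) (F : Sh.{w} G) (U : VKᵒᵖ) :
    Nonempty ((f.inverseImage.obj F).obj.obj U) ↔
      Nonempty ((g.inverseImage.obj F).obj.obj U) := by
  obtain ⟨i⟩ := h
  let a : f.inverseImage ⟶ g.inverseImage := i.hom
  let b : g.inverseImage ⟶ f.inverseImage := i.inv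
  exact ⟨fun ⟨x⟩ ↦ ⟨(a.app F).hom.app U x⟩, fun ⟨x⟩ ↦ ⟨(b.app F).hom.app U x⟩⟩

/-! ### The geometric morphism of a locally constant function -/

/-- The geometric morphism induced by a cover-lifting functor from the virtual knot site: the
inverse image is the sheaf associated with the composition, the direct image is the right Kan
extension. -/
noncomputable def geometricMorphismOfCocontinuous (F : VK ⥤ Opens G)
    [F.IsCocontinuous topologyVK (Opens.grothendieckTopology G)] :
    GeometricMorphism ShVK.{w} (Sh.{w} G) where
  inverseImage := sheafToPresheaf _ _ ⋙ (Functor.whiskeringLeft _ _ _).obj F.op ⋙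
    presheafToSheaf topologyVK (Type (max 1 w))
  directImage := F.sheafPushforwardCocontinuous (Type (max 1 w)) topologyVK
    (Opens.grothendieckTopology G)
  adjunction := ((F.op.ranAdjunction (Type (max 1 w))).comp
      (sheafificationAdjunction topologyVK (Type (max 1 w)))).restrictFullyFaithful
    (fullyFaithfulSheafToPresheaf _ _) (Functor.FullyFaithful.id _)
    (Iso.refl _) (F.sheafPushforwardCocontinuousCompSheafToPresheafIso (Type (max 1 w)) topologyVK
      (Opens.grothendieckTopology G)).symm
  preservesFiniteLimits := by
    infer_instance

variable [DiscreteTopology G]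

/-- The functor that sends an object of the virtual knot site to the set of values of `ν` on its
knots. -/
def valueFunctor (ν : VariableSpaceKnot → G) : VK ⥤ Opens G where
  obj U := ⟨range fun K : U.nbhd ↦ ν (variableSpaceKnot U K), isOpen_discrete _⟩
  map {U V} f := homOfLE <| by
    rintro _ ⟨K, rfl⟩
    exact ⟨VK.Hom.toFun f K, congrArg ν (variableSpaceKnot_toFun f K)⟩

/-- The values of `ν` can be covered by restricting the knots, because `ν` is locally constant. -/
theorem IsLocallyConstantOnVK.isCocontinuous {ν : VariableSpaceKnot → G}
    (hν : IsLocallyConstantOnVK ν) :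
    (valueFunctor ν).IsCocontinuous topologyVK (Opens.grothendieckTopology G) where
  cover_lift {U S} hS K := by
    obtain ⟨H, i, hi, hK⟩ := hS (ν (variableSpaceKnot U K)) ⟨K, rfl⟩
    have hA : IsOpen {J : U.nbhd | ν (variableSpaceKnot U J) ∈ H} := hν U H
    obtain ⟨L, hL⟩ := VK.exists_restrictIncl_eq hA (K := K) hK
    refine ⟨_, U.restrictIncl _ hA, L, ?_, hL⟩
    have hle : (valueFunctor ν).obj (U.restrict _ hA) ≤ H := by
      rintro _ ⟨J, rfl⟩
      have h1 : ν (variableSpaceKnot U (VK.Hom.toFun (U.restrictIncl _ hA) J)) ∈ H :=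
        VK.restrictIncl_mem J
      rwa [variableSpaceKnot_toFun] at h1
    have h2 := S.downward_closed hi (homOfLE hle)
    rwa [Subsingleton.elim (homOfLE hle ≫ i) ((valueFunctor ν).map (U.restrictIncl _ hA))] at h2

theorem IsLocallyConstantOnVK.exists_geometricMorphism {ν : VariableSpaceKnot → G}
    (hν : IsLocallyConstantOnVK ν) :
    ∃ f : GeometricMorphism ShVK.{w} (Sh.{w} G), f.value = ν := by
  have := hν.isCocontinuous
  let f := geometricMorphismOfCocontinuous (valueFunctor ν)
  refine ⟨f, funext fun v ↦ ?_⟩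
  obtain ⟨U, K, rfl, ⟨x⟩⟩ := f.supp_value v
  set H := openSingleton (f.value (variableSpaceKnot U K))
  let Q : ShVK.{w} := predicateSheaf fun v ↦ ν v ∈ H
  let a : (valueFunctor ν).op ⋙ (representable H).obj ⟶ Q.obj :=
    { app := fun U ↦ ↾ fun x ↦ ⟨⟨fun K ↦ nonempty_representable_iff.1 ⟨x⟩ ⟨K, rfl⟩⟩⟩
      naturality := fun _ _ _ ↦ by
        ext
        exact Subsingleton.elim _ _ }
  have h : ν (variableSpaceKnot U K) ∈ H :=
    (((sheafifyLift topologyVK a Q.property).app (op U)) x).down.down K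
  exact (show ν (variableSpaceKnot U K) = _ from h).symm

end

end VirtualKnot

theorem mainTheorem4 (G : Type w) [TopologicalSpace G] [DiscreteTopology G] :
    ∃ e : VirtualKnot.GeometricMorphismClass VirtualKnot.ShVK.{w} (VirtualKnot.Sh.{w} G) ≃
        VirtualKnot.VariableSpaceKnotInvariant G,
      ∀ (f : VirtualKnot.GeometricMorphism VirtualKnot.ShVK.{w} (VirtualKnot.Sh.{w} G))
        (U : VirtualKnot.VK) (H : TopologicalSpace.Opens G),
        Nonempty ((f.inverseImage.obj (VirtualKnot.representable H)).obj.obj (Opposite.op U)) ↔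
          ∀ K : U.nbhd, (e (Quotient.mk _ f)).toFun (VirtualKnot.variableSpaceKnot U K) ∈ H := by
  let inv (f : VirtualKnot.GeometricMorphism VirtualKnot.ShVK.{w} (VirtualKnot.Sh.{w} G)) :
      VirtualKnot.VariableSpaceKnotInvariant G :=
    ⟨f.value, f.isLocallyConstantOnVK_value.eq_of_isotopy⟩
  have hinv : ∀ f g, inv f = inv g ↔ IsIsomorphic f g := by
    intro f g
    constructor
    · intro h
      have hv : f.value = g.value := congrArg VirtualKnot.VariableSpaceKnotInvariant.toFun h
      refine VirtualKnot.isIsomorphic_of_nonempty_iff fun H U ↦ ?_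
      rw [← Opposite.op_unop U, f.nonempty_iff_value_mem, g.nonempty_iff_value_mem, hv]
    · intro h
      have hv : f.value = g.value := by
        funext v
        obtain ⟨U, K, rfl, hf⟩ := f.supp_value v
        exact (g.supp_singleton_iff.1
          ⟨U, K, rfl, (VirtualKnot.nonempty_iff_of_isIsomorphic h _ _).1 hf⟩).symm
      simp only [inv, hv]
  refine ⟨Equiv.ofBijective (Quotient.lift inv fun f g h ↦ (hinv f g).2 h) ⟨?_, ?_⟩,
    fun f U H ↦ f.nonempty_iff_value_mem⟩
  · rintro ⟨f⟩ ⟨g⟩ h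
    exact Quotient.sound ((hinv f g).1 h)
  · rintro ⟨ν, hν⟩
    obtain ⟨f, rfl⟩ :=
      (VirtualKnot.isLocallyConstantOnVK_of_isotopy hν).exists_geometricMorphism
    exact ⟨Quotient.mk _ f, rfl⟩
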